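/- Let $n\ge 1$ be an integer, $0<\alpha<1$, $1\le p<\infty$, $1<q<\infty$, $p\wedge q=\min\{p,q\}$ and $\mathbb R^{1+n}_+=(0,\infty)\times\mathbb R^n$. For $t>0$ and $x\in\mathbb R^n$ let $$K_t^{(\alpha)}(x)=(2\pi)^{-n}\int_{\mathbb R^n}e^{ix\cdot y-t|y|^{2\alpha}}\,dy$$ be the convolution kernel of $e^{-t(-\Delta)^\alpha}$, and for measurable $F\ge 0$ on $\mathbb R^{1+n}_+$ put $$S_\alpha F(t,x)=\int_0^t\int_{\mathbb R^n}K^{(\alpha)}_{t-s}(x-y)F(s,y)\,dy\,ds\in[0,\infty],\qquad \|F\|_{L^q_tL^p_x}=\Big(\int_0^\infty\Big[\int_{\mathbb R^n}F(t,x)^p\,dx\Big]^{q/p}dt\Big)^{1/q}.$$ The $(\alpha,p,q)$-capacity for the operator $\partial_t+(-\Delta)^\alpha$ is defined for compact $K\subset\mathbb R^{1+n}_+$ by $$C^{(\alpha)}_{p,q}(K)=\inf\big\{\|F\|_{L^q_tL^p_x}^{p\wedge q}:\ F\ge 0\text{ measurable},\ S_\alpha F\ge 1\text{ on }K\big\},$$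 for open $G\subset\mathbb R^{1+n}_+$ by $C^{(\alpha)}_{p,q}(G)=\sup\{C^{(\alpha)}_{p,q}(K):K\subset G\text{ compact}\}$, and for arbitrary $E\subset\mathbb R^{1+n}_+$ by $C^{(\alpha)}_{p,q}(E)=\inf\{C^{(\alpha)}_{p,q}(G):E\subset G\subset\mathbb R^{1+n}_+,\ G\text{ open}\}$. For $(t_0,x_0)\in\mathbb R^{1+n}_+$ and $r_0>0$ let $$B^{(\alpha)}_{r_0}(t_0,x_0)=\{(t,x)\in\mathbb R^{1+n}_+:\ |t-t_0|<r_0^{2\alpha},\ |x-x_0|<r_0\}.$$ (i) If $\frac np+\frac{2\alpha}q-2\alpha>0$, then there are constants $0<c\le C<\infty$ depending only on $n,\alpha,p,q$ such that for every $t_0>0$ there is $\delta>0$ with $$c\,r_0^{(p\wedge q)(\frac np+\frac{2\alpha}q-2\alpha)}\le C^{(\alpha)}_{p,q}\big(B^{(\alpha)}_{r_0}(t_0,x_0)\big)\le C\,r_0^{(p\wedge q)(\frac np+\frac{2\alpha}q-2\alpha)}\qquad\text{for all }x_0\in\mathbb R^n,\ 0<r_0<\delta.$$ (ii) If $\frac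 np+\frac{2\alpha}q-2\alpha=0$, then there are constants $0<c\le C<\infty$ depending only on $n,\alpha,p,q$ such that for every $t_0>0$ there is $\delta\in(0,1)$ with $$c\Big(\ln\frac1{r_0}\Big)^{(p\wedge q)(\frac1q-1)}\le C^{(\alpha)}_{p,q}\big(B^{(\alpha)}_{r_0}(t_0,x_0)\big)\le C\Big(\ln\frac1{r_0}\Big)^{(p\wedge q)(\frac1q-1)}\qquad\text{for all }x_0\in\mathbb R^n,\ 0<r_0<\delta.$$ -/

import Mathlib

open MeasureTheory Set
open scoped NNReal ENNReal

noncomputable section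

/-- The open upper half space `(0, ∞) × ℝⁿ`, as a subset of `ℝ × ℝⁿ`. -/
def upperHalfSpace (n : ℕ) : Set (ℝ × EuclideanSpace ℝ (Fin n)) :=
  {z | 0 < z.1}

/-- The convolution kernel of the semigroup `e^{-t (-Δ)^α}` on `ℝⁿ`, for `t > 0`:
`K_t(x) = (2π)^{-n} ∫ e^{i x·y - t |y|^{2α}} dy`.
The integral is a real number, since the integrand is conjugated by `y ↦ -y`. -/
def fracHeatKernel (n : ℕ) (α t : ℝ) (x : EuclideanSpace ℝ (Fin n)) : ℝ :=
  ((2 * Real.pi) ^ n)⁻¹ *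
    (∫ y : EuclideanSpace ℝ (Fin n),
      Complex.exp (Complex.I * ((inner ℝ x y : ℝ) : ℂ) - ((t * ‖y‖ ^ (2 * α) : ℝ) : ℂ))).re

/-- The fractional dissipative potential of a nonnegative function,
`S_α F(t,x) = ∫₀ᵗ ∫ K_{t-s}(x-y) F(s,y) dy ds`, with values in `[0, ∞]`.
Only the values of `F` on the upper half space enter. -/
def fracPotential (n : ℕ) (α : ℝ) (F : ℝ × EuclideanSpace ℝ (Fin n) → ℝ≥0)
    (z : ℝ × EuclideanSpace ℝ (Fin n)) : ℝ≥0∞ :=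
  ∫⁻ s in Ioo 0 z.1, ∫⁻ y : EuclideanSpace ℝ (Fin n),
    ENNReal.ofReal (fracHeatKernel n α (z.1 - s) (z.2 - y)) * (F (s, y) : ℝ≥0∞)

/-- The mixed norm of `L^q_t L^p_x` on the upper half space, for `1 ≤ p, q < ∞`. -/
def mixedNorm (n : ℕ) (p q : ℝ) (F : ℝ × EuclideanSpace ℝ (Fin n) → ℝ≥0) : ℝ≥0∞ :=
  (∫⁻ t in Ioi (0 : ℝ),
    (∫⁻ x : EuclideanSpace ℝ (Fin n), (F (t, x) : ℝ≥0∞) ^ p) ^ (q / p)) ^ (1 / q)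

/-- The `(α, p, q)`-capacity of a compact subset `K` of the upper half space. -/
def capCompact (n : ℕ) (α p q : ℝ) (K : Set (ℝ × EuclideanSpace ℝ (Fin n))) : ℝ≥0∞ :=
  ⨅ (F : ℝ × EuclideanSpace ℝ (Fin n) → ℝ≥0) (_ : Measurable F)
    (_ : ∀ z ∈ K, 1 ≤ fracPotential n α F z), mixedNorm n p q F ^ min p q

/-- The `(α, p, q)`-capacity of an open subset `G` of the upper half space: the supremum of the
capacities of its compact subsets. -/
def capOpen (n : ℕ) (α p q : ℝ) (G : Set (ℝ × EuclideanSpace ℝ (Fin n))) : ℝ≥0∞ :=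
  ⨆ (K : Set (ℝ × EuclideanSpace ℝ (Fin n))) (_ : IsCompact K) (_ : K ⊆ G),
    capCompact n α p q K

/-- The `(α, p, q)`-capacity of an arbitrary subset `E` of the upper half space: the infimum of
the capacities of the open sets containing it. -/
def parabolicCap (n : ℕ) (α p q : ℝ) (E : Set (ℝ × EuclideanSpace ℝ (Fin n))) : ℝ≥0∞ :=
  ⨅ (G : Set (ℝ × EuclideanSpace ℝ (Fin n))) (_ : IsOpen G) (_ : E ⊆ G)
    (_ : G ⊆ upperHalfSpace n), capOpen n α p q G

/-- The parabolic ball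
`{(t,x) ∈ (0,∞) × ℝⁿ : |t - t₀| < r^{2α} and |x - x₀| < r}`. -/
def parabolicBall (n : ℕ) (α r t₀ : ℝ) (x₀ : EuclideanSpace ℝ (Fin n)) :
    Set (ℝ × EuclideanSpace ℝ (Fin n)) :=
  {z | z ∈ upperHalfSpace n ∧ |z.1 - t₀| < r ^ (2 * α) ∧ ‖z.2 - x₀‖ < r}

end

/-! ### The fractional heat kernel -/

/-! Write d = n/p + 2α/q - 2α and let q' be the conjugate exponent of q. Both estimates reduce to a
one-dimensional integral in the elapsed time τ, and they match because n q'/(2αp) = 1 + d q'/(2α).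

Lower bound. The ball contains the compact slice {t₀} × B with B a closed ball of radius r/2. If the
potential of F is at least 1 on the slice, averaging over B and applying Hölder in space
(`setLIntegral_convolution_le`) and then in time gives 1 ≤ J^(1/q') ‖F‖, where J is at most a
constant times ∫₀^{t₀} max(s, r^{2α})^(-n q'/(2αp)) ds. This integral is of order r^(-d q') when d >
0 and at most of order ln(1/r) when d = 0. The kernel enters only through K_t ≤ A t^(-n/2α) and
through its positive part having mass at most 1; no spatial decay is needed.

Upper bound. The test function is c/τ on the part a < τ < b of a backward paraboloid ‖y - x₀‖ ≤ δ
τ^(1/2α) with vertex (t₀, x₀). There the kernel is comparable to τ^(-n/2α), the reciprocal of the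
volume scale of the section, so the potential is at least a constant times c ln(b/a)
(`le_fracPotential_paraboloidFun`), while the norm is at most a constant times c b^(d/2α)
ln(b/a)^(1/q) (`mixedNorm_paraboloidFun_le`). Normalising c gives the bound, with a of order r^{2α}
and b = 2a if d > 0, b = t₀ if d = 0.

The mass bound rests on K ≥ 0, the one place where α < 1 matters: exp(-c‖y‖^{2α}) is a limit of
powers of Gaussian mixtures, whose Fourier transforms are nonnegative (`fracHeatKernel_nonneg`). -/

theorem integrable_exp_neg_mul_norm_rpow (n : ℕ) {a t : ℝ} (ha : 0 < a) (ht : 0 < t) :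
    Integrable (fun y : EuclideanSpace ℝ (Fin n) => Real.exp (-(t * ‖y‖ ^ a))) := by
  have hlim : Filter.Tendsto
      (fun v : ℝ => (v ^ a) ^ (((n : ℝ) + 1) / a) * Real.exp (-t * v ^ a)) Filter.atTop (nhds 0) :=
    (tendsto_rpow_mul_exp_neg_mul_atTop_nhds_zero (((n : ℝ) + 1) / a) t ht).comp
      (tendsto_rpow_atTop ha)
  obtain ⟨R, hR⟩ := Filter.eventually_atTop.1 (hlim.eventually_le_const (u := 1) one_pos)
  set R' : ℝ := max R 1
  have hR1 : (1 : ℝ) ≤ R' := le_max_right _ _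
  have hC : ∀ y : EuclideanSpace ℝ (Fin n), Real.exp (-(t * ‖y‖ ^ a)) ≤
      (1 + R') ^ ((n : ℝ) + 1) * (1 + ‖y‖) ^ (-((n : ℝ) + 1)) := by
    intro y
    have hn0 : (0 : ℝ) ≤ (n : ℝ) + 1 := by positivity
    rw [Real.rpow_neg (by positivity), ← div_eq_mul_inv, le_div_iff₀ (by positivity)]
    rcases le_total ‖y‖ R' with h | h
    · calc Real.exp (-(t * ‖y‖ ^ a)) * (1 + ‖y‖) ^ ((n : ℝ) + 1)
          ≤ 1 * (1 + R') ^ ((n : ℝ) + 1) := by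
            gcongr
            rw [Real.exp_le_one_iff]
            have : 0 ≤ ‖y‖ ^ a := by positivity
            nlinarith
        _ = _ := one_mul _
    · have h1 := hR ‖y‖ ((le_max_left _ _).trans h)
      rw [← Real.rpow_mul (norm_nonneg _), mul_div_cancel₀ _ ha.ne', neg_mul] at h1
      have h2 : 1 + ‖y‖ ≤ (1 + R') * ‖y‖ := by nlinarith [norm_nonneg y]
      calc Real.exp (-(t * ‖y‖ ^ a)) * (1 + ‖y‖) ^ ((n : ℝ) + 1)
          ≤ Real.exp (-(t * ‖y‖ ^ a)) * ((1 + R') * ‖y‖) ^ ((n : ℝ) + 1) := by gcongr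
        _ = (1 + R') ^ ((n : ℝ) + 1) * (‖y‖ ^ ((n : ℝ) + 1) * Real.exp (-(t * ‖y‖ ^ a))) := by
            rw [Real.mul_rpow (by positivity) (norm_nonneg _)]; ring
        _ ≤ (1 + R') ^ ((n : ℝ) + 1) * 1 := by gcongr
        _ = _ := mul_one _
  have hint : Integrable (fun y : EuclideanSpace ℝ (Fin n) =>
      (1 + R') ^ ((n : ℝ) + 1) * (1 + ‖y‖) ^ (-((n : ℝ) + 1))) := by
    refine (integrable_one_add_norm ?_).const_mul _
    simp
  refine hint.mono' (Measurable.aestronglyMeasurable (by fun_prop)) (Filter.Eventually.of_forall fun y => ?_)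
  rw [Real.norm_of_nonneg (Real.exp_pos _).le]
  exact hC y

theorem integrable_cos_mul {V : Type*} [NormedAddCommGroup V] [InnerProductSpace ℝ V]
    [MeasurableSpace V] [BorelSpace V] {μ : Measure V} {f : V → ℝ} (hf : Integrable f μ)
    (x : V) : Integrable (fun y => Real.cos (inner ℝ x y) * f y) μ :=
  hf.bdd_mul (c := 1)
    (Continuous.measurable (by fun_prop)).aestronglyMeasurable
    (Filter.Eventually.of_forall fun y => by simpa using Real.abs_cos_le_one _)

theorem fracHeatKernel_eq_integral_cos (n : ℕ) {α t : ℝ} (hα : 0 < α) (ht : 0 < t)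
    (x : EuclideanSpace ℝ (Fin n)) :
    fracHeatKernel n α t x = ((2 * Real.pi) ^ n)⁻¹ *
      ∫ y : EuclideanSpace ℝ (Fin n),
        Real.cos (inner ℝ x y) * Real.exp (-(t * ‖y‖ ^ (2 * α))) := by
  have hre : ∀ y : EuclideanSpace ℝ (Fin n),
      (Complex.exp (Complex.I * ((inner ℝ x y : ℝ) : ℂ) - ((t * ‖y‖ ^ (2 * α) : ℝ) : ℂ))).re =
        Real.cos (inner ℝ x y) * Real.exp (-(t * ‖y‖ ^ (2 * α))) := by
    intro y
    rw [Complex.exp_re, mul_comm]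
    simp
  have hint : Integrable (fun y : EuclideanSpace ℝ (Fin n) =>
      Complex.exp (Complex.I * ((inner ℝ x y : ℝ) : ℂ) - ((t * ‖y‖ ^ (2 * α) : ℝ) : ℂ))) := by
    refine (integrable_exp_neg_mul_norm_rpow n (a := 2 * α) (by positivity) ht).mono'
      (Measurable.aestronglyMeasurable (by fun_prop)) (Filter.Eventually.of_forall fun y => ?_)
    rw [Complex.norm_exp]
    simp
  unfold fracHeatKernel
  congr 1
  have := integral_re hint
  simp only [RCLike.re_eq_complex_re] at this
  rw [← this]
  exact integral_congr_ae (Filter.Eventually.of_forall hre)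

/-- Self-similarity, by dilating the frequency variable by t^(1/2α). It reduces pointwise bounds and
the sign of the kernel to a single time. -/
theorem fracHeatKernel_scaling (n : ℕ) {α t : ℝ} (hα : 0 < α) (ht : 0 < t)
    (x : EuclideanSpace ℝ (Fin n)) :
    fracHeatKernel n α t x =
      t ^ (-((n : ℝ) / (2 * α))) * fracHeatKernel n α 1 (t ^ (-(1 / (2 * α))) • x) := by
  rw [fracHeatKernel_eq_integral_cos n hα ht, fracHeatKernel_eq_integral_cos n hα one_pos]
  set R : ℝ := t ^ (1 / (2 * α)) with hR
  have hRpos : 0 < R := Real.rpow_pos_of_pos ht _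
  have key := Measure.integral_comp_smul_of_nonneg (volume : Measure (EuclideanSpace ℝ (Fin n)))
    (fun y => Real.cos (inner ℝ (t ^ (-(1 / (2 * α))) • x) y) *
      Real.exp (-(1 * ‖y‖ ^ (2 * α)))) R (hR := hRpos.le)
  have hfin : (R ^ Module.finrank ℝ (EuclideanSpace ℝ (Fin n)))⁻¹ =
      t ^ (-((n : ℝ) / (2 * α))) := by
    rw [finrank_euclideanSpace_fin, hR, ← Real.rpow_natCast, ← Real.rpow_mul ht.le,
      Real.rpow_neg ht.le]
    congr 2
    ring
  rw [hfin, smul_eq_mul] at key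
  rw [mul_left_comm, ← key]
  congr 1
  refine integral_congr_ae (Filter.Eventually.of_forall fun y => ?_)
  simp only
  have h1 : inner ℝ (t ^ (-(1 / (2 * α))) • x) (R • y) = inner ℝ x y := by
    rw [real_inner_smul_left, real_inner_smul_right, ← mul_assoc, hR, ← Real.rpow_add ht]
    simp
  have h2 : 1 * ‖R • y‖ ^ (2 * α) = t * ‖y‖ ^ (2 * α) := by
    rw [norm_smul, Real.norm_of_nonneg hRpos.le, Real.mul_rpow hRpos.le (norm_nonneg _), hR,
      ← Real.rpow_mul ht.le, one_div_mul_cancel (by positivity), Real.rpow_one, one_mul]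
  rw [h1, h2]

theorem exists_fracHeatKernel_le (n : ℕ) {α : ℝ} (hα : 0 < α) :
    ∃ A : ℝ, 0 < A ∧ ∀ t : ℝ, 0 < t → ∀ x : EuclideanSpace ℝ (Fin n),
      fracHeatKernel n α t x ≤ A * t ^ (-((n : ℝ) / (2 * α))) := by
  have hint := integrable_exp_neg_mul_norm_rpow n (a := 2 * α) (by positivity) one_pos
  have h0 : 0 ≤ ∫ y : EuclideanSpace ℝ (Fin n), Real.exp (-(1 * ‖y‖ ^ (2 * α))) :=
    integral_nonneg fun y => (Real.exp_pos _).le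
  refine ⟨((2 * Real.pi) ^ n)⁻¹ *
    (∫ y : EuclideanSpace ℝ (Fin n), Real.exp (-(1 * ‖y‖ ^ (2 * α)))) + 1, by positivity, ?_⟩
  intro t ht x
  rw [fracHeatKernel_scaling n hα ht, mul_comm]
  gcongr
  rw [fracHeatKernel_eq_integral_cos n hα one_pos]
  refine le_add_of_le_of_nonneg (mul_le_mul_of_nonneg_left ?_ (by positivity)) zero_le_one
  refine integral_mono (integrable_cos_mul hint _) hint fun y => ?_
  exact mul_le_of_le_one_left (Real.exp_pos _).le (Real.cos_le_one _)

/-- At time 1 the kernel is continuous and positive at the origin, so it stays above half that value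
nearby; scaling turns the neighbourhood into a paraboloid. -/
theorem exists_le_fracHeatKernel (n : ℕ) {α : ℝ} (hα : 0 < α) :
    ∃ κ ε : ℝ, 0 < κ ∧ 0 < ε ∧ ∀ t : ℝ, 0 < t → ∀ x : EuclideanSpace ℝ (Fin n),
      ‖x‖ ≤ ε * t ^ (1 / (2 * α)) → κ * t ^ (-((n : ℝ) / (2 * α))) ≤ fracHeatKernel n α t x := by
  have hint := integrable_exp_neg_mul_norm_rpow n (a := 2 * α) (by positivity) one_pos
  have hcont : Continuous (fun x : EuclideanSpace ℝ (Fin n) => fracHeatKernel n α 1 x) := by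
    simp_rw [fracHeatKernel_eq_integral_cos n hα one_pos]
    refine continuous_const.mul ?_
    refine continuous_of_dominated (fun x => (integrable_cos_mul hint x).1) (fun x => ?_) hint ?_
    · refine Filter.Eventually.of_forall fun y => ?_
      rw [norm_mul, Real.norm_of_nonneg (Real.exp_pos _).le]
      exact mul_le_of_le_one_left (Real.exp_pos _).le (Real.abs_cos_le_one _)
    · exact Filter.Eventually.of_forall fun y => by fun_prop
  have h0 : 0 < fracHeatKernel n α 1 (0 : EuclideanSpace ℝ (Fin n)) := by
    rw [fracHeatKernel_eq_integral_cos n hα one_pos]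
    have : 0 < ∫ y : EuclideanSpace ℝ (Fin n), Real.exp (-(1 * ‖y‖ ^ (2 * α))) :=
      integral_exp_pos hint
    simp only [inner_zero_left, Real.cos_zero, one_mul] at this ⊢
    positivity
  obtain ⟨ε, hε, hball⟩ := Metric.eventually_nhds_iff.1
    (hcont.continuousAt.eventually_const_le (half_lt_self h0))
  refine ⟨fracHeatKernel n α 1 (0 : EuclideanSpace ℝ (Fin n)) / 2, ε / 2, by positivity,
    by positivity, fun t ht x hx => ?_⟩
  rw [fracHeatKernel_scaling n hα ht, mul_comm]
  gcongr
  apply hball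
  rw [dist_zero_right, norm_smul, Real.norm_of_nonneg (by positivity), Real.rpow_neg ht.le,
    inv_mul_lt_iff₀ (by positivity)]
  have : 0 < t ^ (1 / (2 * α)) := by positivity
  nlinarith

theorem measurable_fracHeatKernel (n : ℕ) (α : ℝ) :
    Measurable (fun z : ℝ × EuclideanSpace ℝ (Fin n) => fracHeatKernel n α z.1 z.2) := by
  unfold fracHeatKernel
  refine measurable_const.mul (Complex.measurable_re.comp ?_)
  refine (StronglyMeasurable.integral_prod_right
    (f := fun (z : ℝ × EuclideanSpace ℝ (Fin n)) (y : EuclideanSpace ℝ (Fin n)) =>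
      Complex.exp (Complex.I * ((inner ℝ z.2 y : ℝ) : ℂ) -
        ((z.1 * ‖y‖ ^ (2 * α) : ℝ) : ℂ))) ?_).measurable
  refine Measurable.stronglyMeasurable ?_
  simp only [Function.uncurry_def]
  fun_prop

/-! ### Gaussian integrals -/

theorem integrable_exp_neg_mul_sq_norm (n : ℕ) {b : ℝ} (hb : 0 < b) :
    Integrable (fun y : EuclideanSpace ℝ (Fin n) => Real.exp (-(b * ‖y‖ ^ 2))) := by
  simpa using integrable_exp_neg_mul_norm_rpow n (a := 2) two_pos hb

theorem integral_cos_mul_exp_neg_mul_sq_norm (n : ℕ) {b : ℝ} (hb : 0 < b)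
    (x : EuclideanSpace ℝ (Fin n)) :
    ∫ y : EuclideanSpace ℝ (Fin n), Real.cos (inner ℝ x y) * Real.exp (-(b * ‖y‖ ^ 2)) =
      (Real.pi / b) ^ ((n : ℝ) / 2) * Real.exp (-(‖x‖ ^ 2 / (4 * b))) := by
  have hb' : 0 < (b : ℂ).re := by simpa using hb
  have h := GaussianFourier.integral_cexp_neg_mul_sq_norm_add hb' Complex.I x
  have hi := GaussianFourier.integrable_cexp_neg_mul_sq_norm_add hb' Complex.I x
  have h2 := integral_re hi
  simp only [RCLike.re_eq_complex_re] at h2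
  rw [h] at h2
  have hrhs : ((Real.pi / b : ℂ) ^ ((Module.finrank ℝ (EuclideanSpace ℝ (Fin n)) : ℂ) / 2) *
      Complex.exp (Complex.I ^ 2 * (‖x‖ : ℂ) ^ 2 / (4 * b))) =
      (((Real.pi / b) ^ ((n : ℝ) / 2) * Real.exp (-(‖x‖ ^ 2 / (4 * b))) : ℝ) : ℂ) := by
    rw [finrank_euclideanSpace_fin]
    push_cast
    rw [Complex.ofReal_cpow (by positivity)]
    push_cast
    congr 2
    rw [Complex.I_sq]
    ring
  rw [hrhs, Complex.ofReal_re] at h2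
  rw [← h2]
  refine integral_congr_ae (Filter.Eventually.of_forall fun y => ?_)
  simp only
  have : -(b : ℂ) * (‖y‖ : ℂ) ^ 2 + Complex.I * ((inner ℝ x y : ℝ) : ℂ) =
      ((-(b * ‖y‖ ^ 2) : ℝ) : ℂ) + ((inner ℝ x y : ℝ) : ℂ) * Complex.I := by
    push_cast; ring
  rw [this, Complex.exp_re]
  simp [mul_comm, pow_two]

/-! ### Positivity of the kernel -/

/-- By Fubini, each factor g averages over s the replacement of the Gaussian parameter b by b + s.
Induction on the power, with b free, ends at the explicit transform of a Gaussian. -/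
theorem integral_cos_mul_exp_mul_pow_nonneg (n : ℕ) {ν : Measure ℝ} [SFinite ν] {w : ℝ → ℝ}
    (hν : ∀ᵐ s ∂ν, 0 ≤ s) (hw : Integrable w ν) (hw0 : ∀ᵐ s ∂ν, 0 ≤ w s)
    {g : EuclideanSpace ℝ (Fin n) → ℝ} (hgm : Measurable g) (hg1 : ∀ y, |g y| ≤ 1)
    (hg : ∀ y, g y = ∫ s, Real.exp (-(s * ‖y‖ ^ 2)) * w s ∂ν) (N : ℕ) :
    ∀ (b : ℝ), 0 < b → ∀ x : EuclideanSpace ℝ (Fin n),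
      0 ≤ ∫ y, Real.cos (inner ℝ x y) * (Real.exp (-(b * ‖y‖ ^ 2)) * g y ^ N) := by
  induction N with
  | zero =>
    intro b hb x
    simp only [pow_zero, mul_one]
    rw [integral_cos_mul_exp_neg_mul_sq_norm n hb]
    have := Real.pi_pos
    positivity
  | succ N ih =>
    intro b hb x
    have hswap : ∫ y : EuclideanSpace ℝ (Fin n),
          Real.cos (inner ℝ x y) * (Real.exp (-(b * ‖y‖ ^ 2)) * g y ^ (N + 1)) =
        ∫ y : EuclideanSpace ℝ (Fin n), ∫ s, Real.cos (inner ℝ x y) *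
          (Real.exp (-((b + s) * ‖y‖ ^ 2)) * g y ^ N) * w s ∂ν := by
      refine integral_congr_ae (Filter.Eventually.of_forall fun y => ?_)
      simp only
      rw [pow_succ (g y) N, ← mul_assoc, ← mul_assoc]
      nth_rewrite 2 [hg y]
      rw [← integral_const_mul]
      refine integral_congr_ae (Filter.Eventually.of_forall fun s => ?_)
      simp only
      rw [add_mul, neg_add, Real.exp_add]
      ring
    rw [hswap, integral_integral_swap]
    · refine integral_nonneg_of_ae ?_
      filter_upwards [hν, hw0] with s hs hws
      rw [integral_mul_const]
      exact mul_nonneg (ih (b + s) (by positivity) x) hws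
    · have hdom : Integrable (fun z : EuclideanSpace ℝ (Fin n) × ℝ =>
          Real.exp (-(b * ‖z.1‖ ^ 2)) * w z.2) (volume.prod ν) :=
        (integrable_exp_neg_mul_sq_norm n hb).mul_prod hw
      refine hdom.mono' ?_ ?_
      · refine AEStronglyMeasurable.mul (Measurable.aestronglyMeasurable (by fun_prop)) ?_
        exact hw.1.comp_snd
      · have h1 : ∀ᵐ z ∂((volume : Measure (EuclideanSpace ℝ (Fin n))).prod ν), 0 ≤ z.2 :=
          Measure.quasiMeasurePreserving_snd.ae hν
        have h2 : ∀ᵐ z ∂((volume : Measure (EuclideanSpace ℝ (Fin n))).prod ν), 0 ≤ w z.2 :=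
          Measure.quasiMeasurePreserving_snd.ae hw0
        filter_upwards [h1, h2] with z hz1 hz2
        simp only [Function.uncurry_def]
        rw [norm_mul, Real.norm_of_nonneg hz2, norm_mul, norm_mul, norm_pow,
          Real.norm_of_nonneg (Real.exp_pos _).le]
        gcongr
        calc ‖Real.cos (inner ℝ x z.1)‖ * (Real.exp (-((b + z.2) * ‖z.1‖ ^ 2)) * ‖g z.1‖ ^ N)
            ≤ 1 * (Real.exp (-(b * ‖z.1‖ ^ 2)) * 1) := by
              gcongr
              · exact Real.abs_cos_le_one _
              · linarith
              · exact pow_le_one₀ (norm_nonneg _) (hg1 _)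
          _ = _ := by ring

/-! ### The Lévy integral representing u^α -/

theorem integrableOn_one_sub_exp_mul_rpow {α u : ℝ} (hα₀ : 0 < α) (hα₁ : α < 1) (hu : 0 ≤ u) :
    IntegrableOn (fun s : ℝ => (1 - Real.exp (-(s * u))) * s ^ (-1 - α)) (Ioi 0) := by
  have hm : Measurable (fun s : ℝ => (1 - Real.exp (-(s * u))) * s ^ (-1 - α)) := by fun_prop
  have h0 : ∀ s : ℝ, 0 < s → 0 ≤ 1 - Real.exp (-(s * u)) := fun s hs => by
    rw [sub_nonneg, Real.exp_le_one_iff]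
    have := mul_nonneg hs.le hu
    linarith
  rw [← Ioc_union_Ioi_eq_Ioi (zero_le_one' ℝ)]
  refine IntegrableOn.union ?_ ?_
  · have hi : IntegrableOn (fun s : ℝ => u * s ^ (-α)) (Ioc 0 1) := by
      refine Integrable.const_mul ?_ _
      have := intervalIntegral.intervalIntegrable_rpow' (a := 0) (b := 1) (r := -α) (by linarith)
      rwa [intervalIntegrable_iff_integrableOn_Ioc_of_le zero_le_one] at this
    refine hi.mono' hm.aestronglyMeasurable ?_
    filter_upwards [ae_restrict_mem measurableSet_Ioc] with s hs
    have hs0 : 0 < s := hs.1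
    rw [Real.norm_of_nonneg (mul_nonneg (h0 s hs0) (by positivity))]
    have h1 : 1 - Real.exp (-(s * u)) ≤ s * u := by
      have := Real.add_one_le_exp (-(s * u))
      linarith
    calc (1 - Real.exp (-(s * u))) * s ^ (-1 - α) ≤ (s * u) * s ^ (-1 - α) := by gcongr
      _ = u * (s ^ (1 : ℝ) * s ^ (-1 - α)) := by rw [Real.rpow_one]; ring
      _ = u * s ^ (-α) := by rw [← Real.rpow_add hs0]; congr 2; ring
  · have hi : IntegrableOn (fun s : ℝ => s ^ (-1 - α)) (Ioi 1) :=
      integrableOn_Ioi_rpow_of_lt (by linarith) one_pos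
    refine hi.mono' hm.aestronglyMeasurable ?_
    filter_upwards [ae_restrict_mem measurableSet_Ioi] with s hs
    have hs0 : 0 < s := one_pos.trans hs
    rw [Real.norm_of_nonneg (mul_nonneg (h0 s hs0) (by positivity))]
    refine mul_le_of_le_one_left (by positivity) ?_
    have := Real.exp_pos (-(s * u))
    linarith

/-- The substitution s ↦ s u. With u = ‖y‖² it exhibits ‖y‖^{2α} as a superposition of the functions
1 - exp(-s‖y‖²). -/
theorem integral_one_sub_exp_mul_rpow (α : ℝ) {u : ℝ} (hα₀ : 0 < α) (hu : 0 ≤ u) :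
    ∫ s in Ioi (0 : ℝ), (1 - Real.exp (-(s * u))) * s ^ (-1 - α) =
      (∫ s in Ioi (0 : ℝ), (1 - Real.exp (-s)) * s ^ (-1 - α)) * u ^ α := by
  rcases hu.eq_or_lt with rfl | hu
  · simp [Real.zero_rpow hα₀.ne']
  have key := integral_comp_mul_right_Ioi
    (fun s : ℝ => (1 - Real.exp (-s)) * s ^ (-1 - α)) 0 hu
  rw [zero_mul, smul_eq_mul] at key
  have h2 : ∫ s in Ioi (0 : ℝ), (1 - Real.exp (-(s * u))) * (s * u) ^ (-1 - α) =
      u ^ (-1 - α) * ∫ s in Ioi (0 : ℝ), (1 - Real.exp (-(s * u))) * s ^ (-1 - α) := by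
    rw [← integral_const_mul]
    refine setIntegral_congr_fun measurableSet_Ioi fun s hs => ?_
    rw [Real.mul_rpow (le_of_lt hs) hu.le]
    ring
  rw [h2] at key
  have h3 : u ^ α * u ^ (-1 - α) * u = 1 := by
    nth_rewrite 3 [← Real.rpow_one u]
    rw [← Real.rpow_add hu, ← Real.rpow_add hu]
    ring_nf
    exact Real.rpow_zero u
  have h5 : u ^ α * u * _ = u ^ α * u * _ := congrArg (fun z => u ^ α * u * z) key
  calc _ = u ^ α * u * (u ^ (-1 - α) *
        ∫ s in Ioi (0 : ℝ), (1 - Real.exp (-(s * u))) * s ^ (-1 - α)) := by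
        linear_combination (-(∫ s in Ioi (0 : ℝ), (1 - Real.exp (-(s * u))) * s ^ (-1 - α))) * h3
    _ = _ := by
        rw [h5]
        field_simp

theorem integral_one_sub_exp_neg_mul_rpow_pos {α : ℝ} (hα₀ : 0 < α) (hα₁ : α < 1) :
    0 < ∫ s in Ioi (0 : ℝ), (1 - Real.exp (-s)) * s ^ (-1 - α) := by
  have hi := integrableOn_one_sub_exp_mul_rpow hα₀ hα₁ zero_le_one
  simp only [mul_one] at hi
  have hpos : ∀ s ∈ Ioi (0 : ℝ), 0 < (1 - Real.exp (-s)) * s ^ (-1 - α) := fun s hs => by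
    have hs' : 0 < s := hs
    have : Real.exp (-s) < 1 := by rw [Real.exp_lt_one_iff]; linarith
    have h2 : 0 < 1 - Real.exp (-s) := by linarith
    positivity
  rw [setIntegral_pos_iff_support_of_nonneg_ae
    ((ae_restrict_mem measurableSet_Ioi).mono fun s hs => (hpos s hs).le) hi]
  have hsub : Ioi (0 : ℝ) ⊆
      Function.support (fun s : ℝ => (1 - Real.exp (-s)) * s ^ (-1 - α)) ∩ Ioi 0 :=
    fun s hs => ⟨(hpos s hs).ne', hs⟩
  exact lt_of_lt_of_le (by simp) (measure_mono hsub)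

open Filter Topology in
/-- Positivity of the Fourier transform of `exp (-c ‖y‖ ^ (2 * α))`: this function is the limit of
powers of mixtures of Gaussians. -/
theorem integral_cos_mul_exp_neg_const_mul_norm_rpow_nonneg (n : ℕ) {α : ℝ} (hα₀ : 0 < α)
    (hα₁ : α < 1) (x : EuclideanSpace ℝ (Fin n)) :
    0 ≤ ∫ y : EuclideanSpace ℝ (Fin n), Real.cos (inner ℝ x y) *
      Real.exp (-((∫ s in Ioi (0 : ℝ), (1 - Real.exp (-s)) * s ^ (-1 - α)) *
        ‖y‖ ^ (2 * α))) := by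
  set c : ℝ := ∫ s in Ioi (0 : ℝ), (1 - Real.exp (-s)) * s ^ (-1 - α) with hc
  have hcpos : 0 < c := integral_one_sub_exp_neg_mul_rpow_pos hα₀ hα₁
  -- The cutoff is chosen so that s^(-1-α) has mass exactly N + 1 on (η N, ∞). Then `w N` is a
  -- probability density, and 1 - g N y is 1/(N+1) times the truncated Lévy integral.
  let η : ℕ → ℝ := fun N => (α * (N + 1)) ^ (-(1 / α))
  have hη : ∀ N, 0 < η N := fun N => by positivity
  have hηα : ∀ N, η N ^ (-α) = α * (N + 1) := fun N => by
    simp only [η]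
    rw [← Real.rpow_mul (by positivity)]
    field_simp
    simp
  have hηanti : Antitone η := fun M N hMN => by
    simp only [η]
    refine Real.rpow_le_rpow_of_nonpos (by positivity) ?_ (by simp [hα₀.le])
    gcongr
  have hη0 : Tendsto η atTop (𝓝 0) := by
    refine (tendsto_rpow_neg_atTop (by positivity : 0 < 1 / α)).comp ?_
    exact (tendsto_atTop_add_const_right _ _ tendsto_natCast_atTop_atTop).const_mul_atTop hα₀
  let w : ℕ → ℝ → ℝ := fun N s => s ^ (-1 - α) / (N + 1)
  have hpow : ∀ N, IntegrableOn (fun s : ℝ => s ^ (-1 - α)) (Ioi (η N)) := fun N =>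
    integrableOn_Ioi_rpow_of_lt (by linarith) (hη N)
  have hmass : ∀ N, ∫ s in Ioi (η N), s ^ (-1 - α) = N + 1 := fun N => by
    rw [integral_Ioi_rpow_of_lt (by linarith) (hη N)]
    have : -1 - α + 1 = -α := by ring
    rw [this, hηα]
    field_simp
  have hwint : ∀ N, Integrable (w N) (volume.restrict (Ioi (η N))) := fun N =>
    (hpow N).div_const _
  have hs0 : ∀ N, ∀ᵐ s ∂(volume.restrict (Ioi (η N))), 0 < s := fun N =>
    (ae_restrict_mem measurableSet_Ioi).mono fun s hs => (hη N).trans hs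
  have hw0 : ∀ N, ∀ᵐ s ∂(volume.restrict (Ioi (η N))), 0 ≤ w N s := fun N => by
    filter_upwards [hs0 N] with s hs
    simp only [w]
    positivity
  let g : ℕ → EuclideanSpace ℝ (Fin n) → ℝ := fun N y =>
    ∫ s in Ioi (η N), Real.exp (-(s * ‖y‖ ^ 2)) * w N s
  have hgm : ∀ N, Measurable (g N) := fun N => by
    refine (StronglyMeasurable.integral_prod_right
      (f := fun (y : EuclideanSpace ℝ (Fin n)) (s : ℝ) =>
        Real.exp (-(s * ‖y‖ ^ 2)) * w N s) ?_).measurable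
    refine Measurable.stronglyMeasurable ?_
    simp only [Function.uncurry_def, w]
    fun_prop
  have hgi : ∀ N (y : EuclideanSpace ℝ (Fin n)), Integrable
      (fun s => Real.exp (-(s * ‖y‖ ^ 2)) * w N s) (volume.restrict (Ioi (η N))) := fun N y => by
    refine (hwint N).bdd_mul (c := 1) (Measurable.aestronglyMeasurable (by fun_prop)) ?_
    filter_upwards [hs0 N] with s hs
    rw [Real.norm_of_nonneg (Real.exp_pos _).le, Real.exp_le_one_iff, neg_nonpos]
    positivity
  have hwmass : ∀ N, ∫ s in Ioi (η N), w N s = 1 := fun N => by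
    simp only [w]
    rw [integral_div, hmass]
    field_simp
  have hgnn : ∀ N y, 0 ≤ g N y := fun N y => integral_nonneg_of_ae (by
    filter_upwards [hw0 N] with s hs
    have := Real.exp_pos (-(s * ‖y‖ ^ 2))
    simp only [Pi.zero_apply]
    positivity)
  have hg1 : ∀ N y, |g N y| ≤ 1 := fun N y => by
    rw [abs_of_nonneg (hgnn N y), ← hwmass N]
    refine integral_mono_ae (hgi N y) (hwint N) ?_
    filter_upwards [hw0 N, hs0 N] with s hs hs'
    refine mul_le_of_le_one_left hs ?_
    rw [Real.exp_le_one_iff, neg_nonpos]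
    positivity
  have hlim : ∀ y, Tendsto (fun N => g N y ^ (N + 1)) atTop
      (𝓝 (Real.exp (-(c * ‖y‖ ^ (2 * α))))) := fun y => by
    have hu : (0 : ℝ) ≤ ‖y‖ ^ 2 := by positivity
    have hun : (⋃ N, Ioi (η N)) = Ioi (0 : ℝ) := by
      ext s
      simp only [mem_iUnion, mem_Ioi]
      refine ⟨fun ⟨N, hN⟩ => (hη N).trans hN, fun hs => ?_⟩
      exact (hη0.eventually_lt_const hs).exists
    have h1 : Tendsto (fun N => ∫ s in Ioi (η N),
        (1 - Real.exp (-(s * ‖y‖ ^ 2))) * s ^ (-1 - α)) atTop (𝓝 (c * ‖y‖ ^ (2 * α))) := by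
      have := tendsto_setIntegral_of_monotone (μ := volume) (s := fun N => Ioi (η N))
        (f := fun s : ℝ => (1 - Real.exp (-(s * ‖y‖ ^ 2))) * s ^ (-1 - α))
        (fun _ => measurableSet_Ioi) (fun M N hMN => Ioi_subset_Ioi (hηanti hMN))
        (by rw [hun]; exact integrableOn_one_sub_exp_mul_rpow hα₀ hα₁ hu)
      rw [hun, integral_one_sub_exp_mul_rpow α hα₀ hu] at this
      have hsq : (‖y‖ ^ 2) ^ α = ‖y‖ ^ (2 * α) := by
        rw [← Real.rpow_two, ← Real.rpow_mul (norm_nonneg _)]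
      rw [hsq] at this
      exact this
    have h2 : ∀ N : ℕ, ((N + 1 : ℕ) : ℝ) * (g N y - 1) = -∫ s in Ioi (η N),
        (1 - Real.exp (-(s * ‖y‖ ^ 2))) * s ^ (-1 - α) := fun N => by
      have hsub : g N y - 1 = g N y - ∫ s in Ioi (η N), w N s := by rw [hwmass]
      rw [hsub]
      simp only [g]
      rw [← integral_sub (hgi N y) (hwint N), ← integral_const_mul, ← integral_neg]
      refine integral_congr_ae (Filter.Eventually.of_forall fun s => ?_)
      simp only [w]
      push_cast
      field_simp
      ring
    -- Reindexing by m = N + 1 gives the form (1 + G m)^m with m * G m convergent; the value at m =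
    -- 0 is irrelevant.
    let G : ℕ → ℝ := fun m => g (m - 1) y - 1
    have h3 : Tendsto (fun m : ℕ => (m : ℝ) * G m) atTop (𝓝 (-(c * ‖y‖ ^ (2 * α)))) := by
      rw [← tendsto_add_atTop_iff_nat 1]
      refine h1.neg.congr fun N => ?_
      rw [← h2 N]
      simp [G]
    have h4 := Real.tendsto_one_add_pow_exp_of_tendsto h3
    rw [← tendsto_add_atTop_iff_nat 1] at h4
    refine h4.congr fun N => ?_
    simp [G]
  -- The extra Gaussian is an integrable majorant uniform in N. It is removed afterwards by letting
  -- b = 1/(k+1) tend to 0, with exp(-c‖y‖^{2α}) as majorant.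
  have hgauss : ∀ b : ℝ, 0 < b → 0 ≤ ∫ y : EuclideanSpace ℝ (Fin n), Real.cos (inner ℝ x y) *
      (Real.exp (-(b * ‖y‖ ^ 2)) * Real.exp (-(c * ‖y‖ ^ (2 * α)))) := fun b hb => by
    refine ge_of_tendsto' (f := fun N => ∫ y : EuclideanSpace ℝ (Fin n),
      Real.cos (inner ℝ x y) * (Real.exp (-(b * ‖y‖ ^ 2)) * g N y ^ (N + 1))) (x := atTop) ?_
      fun N => integral_cos_mul_exp_mul_pow_nonneg n ((hs0 N).mono fun s hs => hs.le) (hwint N)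
        (hw0 N) (hgm N) (hg1 N) (fun y => rfl) (N + 1) b hb x
    refine tendsto_integral_of_dominated_convergence _ (fun N => ?_)
      (integrable_exp_neg_mul_sq_norm n hb) (fun N => ?_) ?_
    · have := hgm N
      exact Measurable.aestronglyMeasurable (by fun_prop)
    · refine Eventually.of_forall fun y => ?_
      rw [norm_mul, norm_mul, norm_pow, Real.norm_of_nonneg (Real.exp_pos _).le]
      calc ‖Real.cos (inner ℝ x y)‖ * (Real.exp (-(b * ‖y‖ ^ 2)) * ‖g N y‖ ^ (N + 1))
          ≤ 1 * (Real.exp (-(b * ‖y‖ ^ 2)) * 1) := by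
            gcongr
            · exact Real.abs_cos_le_one _
            · exact pow_le_one₀ (norm_nonneg _) (hg1 N y)
        _ = _ := by ring
    · exact Eventually.of_forall fun y => ((hlim y).const_mul _).const_mul _
  refine ge_of_tendsto' (f := fun k : ℕ => ∫ y : EuclideanSpace ℝ (Fin n),
    Real.cos (inner ℝ x y) * (Real.exp (-(1 / ((k : ℝ) + 1) * ‖y‖ ^ 2)) *
      Real.exp (-(c * ‖y‖ ^ (2 * α))))) (x := atTop) ?_
    fun k => hgauss _ (by positivity)
  refine tendsto_integral_of_dominated_convergence _ (fun N => ?_)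
      (integrable_exp_neg_mul_norm_rpow n (a := 2 * α) (by positivity) hcpos) (fun N => ?_) ?_
  · exact Measurable.aestronglyMeasurable (by fun_prop)
  · refine Eventually.of_forall fun y => ?_
    rw [norm_mul, norm_mul, Real.norm_of_nonneg (Real.exp_pos _).le,
      Real.norm_of_nonneg (Real.exp_pos _).le]
    calc ‖Real.cos (inner ℝ x y)‖ * (Real.exp (-(1 / ((N : ℝ) + 1) * ‖y‖ ^ 2)) *
          Real.exp (-(c * ‖y‖ ^ (2 * α))))
        ≤ 1 * (1 * Real.exp (-(c * ‖y‖ ^ (2 * α)))) := by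
          gcongr
          · exact Real.abs_cos_le_one _
          · rw [Real.exp_le_one_iff, neg_nonpos]
            positivity
      _ = _ := by ring
  · refine Eventually.of_forall fun y => ?_
    have h1 : Tendsto (fun k : ℕ => Real.exp (-(1 / ((k : ℝ) + 1) * ‖y‖ ^ 2))) atTop (𝓝 1) := by
      have h2 := (tendsto_one_div_add_atTop_nhds_zero_nat (𝕜 := ℝ)).mul_const (‖y‖ ^ 2)
      have h3 := (Real.continuous_exp.tendsto _).comp h2.neg
      simpa [Function.comp_def] using h3
    have := (h1.mul_const (Real.exp (-(c * ‖y‖ ^ (2 * α))))).const_mul (Real.cos (inner ℝ x y))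
    simpa using this

/-- The Gaussian-mixture argument gives the sign at the particular time t = c, the Lévy constant;
scaling carries it to time 1 and then to every time. -/
theorem fracHeatKernel_nonneg (n : ℕ) {α : ℝ} (hα₀ : 0 < α) (hα₁ : α < 1) {t : ℝ} (ht : 0 < t)
    (x : EuclideanSpace ℝ (Fin n)) : 0 ≤ fracHeatKernel n α t x := by
  set c : ℝ := ∫ s in Ioi (0 : ℝ), (1 - Real.exp (-s)) * s ^ (-1 - α) with hc
  have hcpos : 0 < c := integral_one_sub_exp_neg_mul_rpow_pos hα₀ hα₁
  have hcn : ∀ y : EuclideanSpace ℝ (Fin n), 0 ≤ fracHeatKernel n α c y := fun y => by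
    rw [fracHeatKernel_eq_integral_cos n hα₀ hcpos]
    have := integral_cos_mul_exp_neg_const_mul_norm_rpow_nonneg n hα₀ hα₁ y
    positivity
  have h1 : ∀ y : EuclideanSpace ℝ (Fin n), 0 ≤ fracHeatKernel n α 1 y := fun y => by
    have h := hcn ((c ^ (-(1 / (2 * α))))⁻¹ • y)
    rw [fracHeatKernel_scaling n hα₀ hcpos, smul_inv_smul₀ (by positivity)] at h
    exact nonneg_of_mul_nonneg_right h (by positivity)
  rw [fracHeatKernel_scaling n hα₀ ht]
  exact mul_nonneg (by positivity) (h1 _)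

/-! ### The mass of the kernel -/

theorem measurable_fracHeatKernel_right (n : ℕ) (α t : ℝ) :
    Measurable (fun x : EuclideanSpace ℝ (Fin n) => fracHeatKernel n α t x) :=
  Measurable.of_uncurry_left (f := fracHeatKernel n α) (measurable_fracHeatKernel n α)

/-- The Gaussian damping makes the x-integral absolutely convergent before integrability of the
kernel is known. After Fubini, discarding exp(-t‖y‖^{2α}) ≤ 1 leaves a Gaussian integral equal to
(2π)^n for every b. -/
theorem lintegral_fracHeatKernel_mul_gaussian_le (n : ℕ) {α : ℝ} (hα₀ : 0 < α) (hα₁ : α < 1)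
    {t b : ℝ} (ht : 0 < t) (hb : 0 < b) :
    ∫⁻ x : EuclideanSpace ℝ (Fin n),
      ENNReal.ofReal (fracHeatKernel n α t x * Real.exp (-(b * ‖x‖ ^ 2))) ≤ 1 := by
  obtain ⟨A, hA, hbound⟩ := exists_fracHeatKernel_le n hα₀
  have hmeas : Measurable (fun x : EuclideanSpace ℝ (Fin n) => fracHeatKernel n α t x) :=
    measurable_fracHeatKernel_right n α t
  have hint : Integrable (fun x : EuclideanSpace ℝ (Fin n) =>
      fracHeatKernel n α t x * Real.exp (-(b * ‖x‖ ^ 2))) := by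
    refine (integrable_exp_neg_mul_sq_norm n hb).bdd_mul
      (c := A * t ^ (-((n : ℝ) / (2 * α)))) hmeas.aestronglyMeasurable ?_
    refine Filter.Eventually.of_forall fun x => ?_
    rw [Real.norm_of_nonneg (fracHeatKernel_nonneg n hα₀ hα₁ ht x)]
    exact hbound t ht x
  rw [← ofReal_integral_eq_lintegral_ofReal hint (Filter.Eventually.of_forall fun x =>
    mul_nonneg (fracHeatKernel_nonneg n hα₀ hα₁ ht x) (Real.exp_pos _).le)]
  refine ENNReal.ofReal_le_one.2 ?_
  have hexp := integrable_exp_neg_mul_norm_rpow n (a := 2 * α) (by positivity) ht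
  have hpi := Real.pi_pos
  have hswap : ∫ x : EuclideanSpace ℝ (Fin n),
      fracHeatKernel n α t x * Real.exp (-(b * ‖x‖ ^ 2)) =
      ((2 * Real.pi) ^ n)⁻¹ * ∫ y : EuclideanSpace ℝ (Fin n), ∫ x : EuclideanSpace ℝ (Fin n),
        Real.cos (inner ℝ y x) * Real.exp (-(b * ‖x‖ ^ 2)) *
          Real.exp (-(t * ‖y‖ ^ (2 * α))) := by
    rw [integral_integral_swap, ← integral_const_mul]
    · refine integral_congr_ae (Filter.Eventually.of_forall fun x => ?_)
      simp only
      rw [fracHeatKernel_eq_integral_cos n hα₀ ht, mul_assoc, ← integral_mul_const]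
      congr 1
      refine integral_congr_ae (Filter.Eventually.of_forall fun y => ?_)
      simp only
      rw [real_inner_comm]
      ring
    · refine (hexp.mul_prod (integrable_exp_neg_mul_sq_norm n hb)).mono'
        (Measurable.aestronglyMeasurable ?_) (Filter.Eventually.of_forall fun z => ?_)
      · simp only [Function.uncurry_def]
        fun_prop
      · simp only [Function.uncurry_def]
        rw [norm_mul, norm_mul, Real.norm_of_nonneg (Real.exp_pos _).le,
          Real.norm_of_nonneg (Real.exp_pos _).le, mul_comm]
        gcongr
        exact mul_le_of_le_one_left (Real.exp_pos _).le (Real.abs_cos_le_one _)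
  rw [hswap, inv_mul_le_iff₀ (by positivity), mul_one]
  have hinner : ∀ y : EuclideanSpace ℝ (Fin n), ∫ x : EuclideanSpace ℝ (Fin n),
        Real.cos (inner ℝ y x) * Real.exp (-(b * ‖x‖ ^ 2)) * Real.exp (-(t * ‖y‖ ^ (2 * α))) =
      (Real.pi / b) ^ ((n : ℝ) / 2) * Real.exp (-(‖y‖ ^ 2 / (4 * b))) *
        Real.exp (-(t * ‖y‖ ^ (2 * α))) := fun y => by
    rw [integral_mul_const, integral_cos_mul_exp_neg_mul_sq_norm n hb]
  simp_rw [hinner]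
  have hg : ∫ y : EuclideanSpace ℝ (Fin n), Real.exp (-(‖y‖ ^ 2 / (4 * b))) =
      (4 * b * Real.pi) ^ ((n : ℝ) / 2) := by
    have h := integral_cos_mul_exp_neg_mul_sq_norm n (b := 1 / (4 * b)) (by positivity) 0
    simp only [inner_zero_left, Real.cos_zero, one_mul, norm_zero, one_div_mul_eq_div] at h
    have hc : Real.pi / (1 / (4 * b)) = 4 * b * Real.pi := by field_simp
    rw [h, hc]
    simp
  have hgi : Integrable (fun y : EuclideanSpace ℝ (Fin n) =>
      Real.exp (-(‖y‖ ^ 2 / (4 * b)))) := by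
    have h := integrable_exp_neg_mul_sq_norm n (b := 1 / (4 * b)) (by positivity)
    simpa only [one_div_mul_eq_div] using h
  calc ∫ y : EuclideanSpace ℝ (Fin n), (Real.pi / b) ^ ((n : ℝ) / 2) *
        Real.exp (-(‖y‖ ^ 2 / (4 * b))) * Real.exp (-(t * ‖y‖ ^ (2 * α)))
      ≤ ∫ y : EuclideanSpace ℝ (Fin n), (Real.pi / b) ^ ((n : ℝ) / 2) *
        Real.exp (-(‖y‖ ^ 2 / (4 * b))) := by
        refine integral_mono_of_nonneg (Filter.Eventually.of_forall fun y => by positivity)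
          (hgi.const_mul _) (Filter.Eventually.of_forall fun y => ?_)
        refine mul_le_of_le_one_right (by positivity) ?_
        rw [Real.exp_le_one_iff, neg_nonpos]
        positivity
    _ = (2 * Real.pi) ^ n := by
        rw [integral_const_mul, hg, ← Real.mul_rpow (by positivity) (by positivity),
          ← Real.rpow_natCast]
        have : Real.pi / b * (4 * b * Real.pi) = (2 * Real.pi) ^ (2 : ℝ) := by
          rw [Real.rpow_two]; field_simp; ring
        rw [this, ← Real.rpow_mul (by positivity)]
        congr 1
        ring

/-- Monotone convergence as the damping is removed; the monotonicity uses positivity of the kernel.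
-/
theorem lintegral_fracHeatKernel_le_one (n : ℕ) {α : ℝ} (hα₀ : 0 < α) (hα₁ : α < 1)
    {t : ℝ} (ht : 0 < t) :
    ∫⁻ x : EuclideanSpace ℝ (Fin n), ENNReal.ofReal (fracHeatKernel n α t x) ≤ 1 := by
  have hmeas : Measurable (fun x : EuclideanSpace ℝ (Fin n) => fracHeatKernel n α t x) :=
    measurable_fracHeatKernel_right n α t
  let f : ℕ → EuclideanSpace ℝ (Fin n) → ℝ≥0∞ := fun k x =>
    ENNReal.ofReal (fracHeatKernel n α t x * Real.exp (-(1 / ((k : ℝ) + 1) * ‖x‖ ^ 2)))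
  have hfm : ∀ k, AEMeasurable (f k) := fun k => Measurable.aemeasurable (by fun_prop)
  have hmono : ∀ x, Monotone fun k => f k x := fun x k l hkl => by
    refine ENNReal.ofReal_le_ofReal ?_
    have := fracHeatKernel_nonneg n hα₀ hα₁ ht x
    gcongr
  have hlim : ∀ x, Filter.Tendsto (fun k => f k x) Filter.atTop
      (nhds (ENNReal.ofReal (fracHeatKernel n α t x))) := fun x => by
    refine ENNReal.tendsto_ofReal ?_
    have h2 := (tendsto_one_div_add_atTop_nhds_zero_nat (𝕜 := ℝ)).mul_const (‖x‖ ^ 2)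
    have h3 := ((Real.continuous_exp.tendsto _).comp h2.neg).const_mul (fracHeatKernel n α t x)
    simpa [Function.comp_def] using h3
  exact le_of_tendsto' (lintegral_tendsto_of_tendsto_of_monotone hfm
    (Filter.Eventually.of_forall hmono) (Filter.Eventually.of_forall hlim))
    fun k => lintegral_fracHeatKernel_mul_gaussian_le n hα₀ hα₁ ht (by positivity)

/-! ### Lower bound for the capacity -/

theorem mul_eq_rpow_mul_rpow_one_div (k f : ℝ≥0∞) {p : ℝ} (hp : 1 ≤ p) :
    k * f = k ^ (1 - 1 / p) * (k * f ^ p) ^ (1 / p) := by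
  have hp0 : 0 < p := by linarith
  have h1 : 0 ≤ 1 - 1 / p := by
    rw [sub_nonneg, div_le_one hp0]; exact hp
  rw [ENNReal.mul_rpow_of_nonneg _ _ (by positivity), ← ENNReal.rpow_mul,
    mul_one_div_cancel hp0.ne', ENNReal.rpow_one, ← mul_assoc,
    ← ENNReal.rpow_add_of_nonneg _ _ h1 (by positivity)]
  simp

/-- Hölder on B × E for the measure weighted by k(x - y), with exponents 1 - 1/p and 1/p, so that p
= 1 is included. The minimum interpolates between the regimes where k is concentrated or spread out
relative to B. -/
theorem setLIntegral_convolution_le {E : Type*} [NormedAddCommGroup E] [MeasurableSpace E]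
    [BorelSpace E] [SecondCountableTopology E] {μ : Measure E} [SFinite μ] [μ.IsAddHaarMeasure] [μ.IsNegInvariant]
    {k f : E → ℝ≥0∞} (hk : Measurable k) (hf : Measurable f) (hk1 : ∫⁻ x, k x ∂μ ≤ 1)
    {A : ℝ≥0∞} (hkA : ∀ x, k x ≤ A) {B : Set E} (hB0 : μ B ≠ 0) (hB : μ B ≠ ∞)
    {p : ℝ} (hp : 1 ≤ p) :
    ∫⁻ x in B, ∫⁻ y, k (x - y) * f y ∂μ ∂μ ≤
      μ B * (min (μ B)⁻¹ A ^ (1 / p) * (∫⁻ y, f y ^ p ∂μ) ^ (1 / p)) := by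
  have hp0 : 0 < p := by linarith
  have h1 : 0 ≤ 1 - 1 / p := by
    rw [sub_nonneg, div_le_one hp0]; exact hp
  have hmass : ∫⁻ z, k (z.1 - z.2) ∂((μ.restrict B).prod μ) ≤ μ B := by
    rw [lintegral_prod _ (by fun_prop)]
    calc ∫⁻ x in B, ∫⁻ y, k (x - y) ∂μ ∂μ ≤ ∫⁻ x in B, 1 ∂μ := by
          refine lintegral_mono fun x => ?_
          rw [lintegral_sub_left_eq_self k x]
          exact hk1
      _ = μ B := by simp
  have hpow : ∫⁻ z, k (z.1 - z.2) * f z.2 ^ p ∂((μ.restrict B).prod μ) ≤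
      μ B * min (μ B)⁻¹ A * ∫⁻ y, f y ^ p ∂μ := by
    rw [lintegral_prod_symm _ (by fun_prop), ← lintegral_const_mul _ (by fun_prop)]
    refine lintegral_mono fun y => ?_
    simp only
    rw [lintegral_mul_const _ (by fun_prop)]
    gcongr
    -- For fixed y, the integral of k(x - y) over B is at most the total mass 1 and also at most A
    -- times the measure of B.
    rw [mul_min]
    refine le_min ?_ ?_
    · rw [ENNReal.mul_inv_cancel hB0 hB]
      refine (setLIntegral_le_lintegral _ _).trans ?_
      rw [lintegral_sub_right_eq_self k y]
      exact hk1
    · calc ∫⁻ x in B, k (x - y) ∂μ ≤ ∫⁻ x in B, A ∂μ := lintegral_mono fun x => hkA _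
        _ = μ B * A := by simp [mul_comm]
  have hmul : μ B ^ (1 - 1 / p) * μ B ^ (1 / p) = μ B := by
    rw [← ENNReal.rpow_add_of_nonneg _ _ h1 (by positivity)]
    simp
  calc ∫⁻ x in B, ∫⁻ y, k (x - y) * f y ∂μ ∂μ
      = ∫⁻ z, k (z.1 - z.2) * f z.2 ∂((μ.restrict B).prod μ) := by
        rw [lintegral_prod _ (by fun_prop)]
    _ = ∫⁻ z, k (z.1 - z.2) ^ (1 - 1 / p) * (k (z.1 - z.2) * f z.2 ^ p) ^ (1 / p)
          ∂((μ.restrict B).prod μ) :=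
        lintegral_congr fun z => mul_eq_rpow_mul_rpow_one_div _ _ hp
    _ ≤ (∫⁻ z, k (z.1 - z.2) ∂((μ.restrict B).prod μ)) ^ (1 - 1 / p) *
          (∫⁻ z, k (z.1 - z.2) * f z.2 ^ p ∂((μ.restrict B).prod μ)) ^ (1 / p) :=
        ENNReal.lintegral_mul_norm_pow_le (by fun_prop) (by fun_prop) h1 (by positivity) (by ring)
    _ ≤ μ B ^ (1 - 1 / p) * (μ B * min (μ B)⁻¹ A * ∫⁻ y, f y ^ p ∂μ) ^ (1 / p) := by
        gcongr
    _ = _ := by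
        rw [ENNReal.mul_rpow_of_nonneg _ _ (by positivity),
          ENNReal.mul_rpow_of_nonneg _ _ (by positivity), mul_assoc, ← mul_assoc, hmul]

theorem setLIntegral_Ioo_comp_sub_left (h : ℝ → ℝ≥0∞) (t : ℝ) :
    ∫⁻ s in Ioo 0 t, h (t - s) = ∫⁻ s in Ioo 0 t, h s := by
  rw [← lintegral_indicator measurableSet_Ioo, ← lintegral_indicator measurableSet_Ioo,
    ← lintegral_sub_left_eq_self _ t]
  refine lintegral_congr fun s => ?_
  have : t - s ∈ Ioo 0 t ↔ s ∈ Ioo 0 t := by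
    simp only [mem_Ioo]
    constructor <;> rintro ⟨h1, h2⟩ <;> constructor <;> linarith
  by_cases hs : s ∈ Ioo 0 t
  · rw [indicator_of_mem hs, indicator_of_mem (this.2 hs), sub_sub_cancel]
  · rw [indicator_of_notMem hs, indicator_of_notMem (fun h => hs (this.1 h))]

theorem setLIntegral_mul_le_mixedNorm (n : ℕ) {p q q' : ℝ} (hq : q.HolderConjugate q')
    {F : ℝ × EuclideanSpace ℝ (Fin n) → ℝ≥0} (hF : Measurable F) {m : ℝ → ℝ≥0∞}
    (hm : Measurable m) (t : ℝ) :
    ∫⁻ s in Ioo 0 t, m (t - s) *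
        (∫⁻ y : EuclideanSpace ℝ (Fin n), (F (s, y) : ℝ≥0∞) ^ p) ^ (1 / p) ≤
      (∫⁻ s in Ioo 0 t, m s ^ q') ^ (1 / q') * mixedNorm n p q F := by
  have hFm : Measurable fun s : ℝ => ∫⁻ y : EuclideanSpace ℝ (Fin n), (F (s, y) : ℝ≥0∞) ^ p :=
    Measurable.lintegral_prod_right' (f := fun z : ℝ × EuclideanSpace ℝ (Fin n) =>
      (F z : ℝ≥0∞) ^ p) (by fun_prop)
  refine (ENNReal.lintegral_mul_le_Lp_mul_Lq _ hq.symm (by fun_prop) (by fun_prop)).trans ?_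
  rw [setLIntegral_Ioo_comp_sub_left (fun s => m s ^ q') t]
  gcongr
  unfold mixedNorm
  have hq0 := hq.pos
  refine ENNReal.rpow_le_rpow ?_ (by positivity)
  refine (lintegral_mono_set Ioo_subset_Ioi_self).trans (lintegral_mono fun s => ?_)
  simp only
  rw [← ENNReal.rpow_mul, one_div_mul_eq_div]

/-- Integrate the constraint over the slice, exchange the x and s integrals, bound each time by the
spatial convolution estimate, cancel the volume of B, and finish with Hölder in time. -/
theorem one_le_mul_mixedNorm_of_one_le_fracPotential (n : ℕ) {α p q q' : ℝ} (hα₀ : 0 < α)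
    (hα₁ : α < 1) (hp : 1 ≤ p) (hq : q.HolderConjugate q') {A : ℝ}
    (hA : ∀ t : ℝ, 0 < t → ∀ x : EuclideanSpace ℝ (Fin n),
      fracHeatKernel n α t x ≤ A * t ^ (-((n : ℝ) / (2 * α))))
    {F : ℝ × EuclideanSpace ℝ (Fin n) → ℝ≥0} (hF : Measurable F) {t₀ : ℝ}
    {B : Set (EuclideanSpace ℝ (Fin n))} (hB0 : volume B ≠ 0) (hB : volume B ≠ ∞)
    (hBm : MeasurableSet B) (hSF : ∀ x ∈ B, 1 ≤ fracPotential n α F (t₀, x)) :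
    1 ≤ (∫⁻ s in Ioo 0 t₀, (min (volume B)⁻¹
      (ENNReal.ofReal (A * s ^ (-((n : ℝ) / (2 * α))))) ^ (1 / p)) ^ q') ^ (1 / q') *
        mixedNorm n p q F := by
  have hK := measurable_fracHeatKernel n α
  have hjoint : Measurable fun z : (EuclideanSpace ℝ (Fin n) × ℝ) × EuclideanSpace ℝ (Fin n) =>
      ENNReal.ofReal (fracHeatKernel n α (t₀ - z.1.2) (z.1.1 - z.2)) *
        (F (z.1.2, z.2) : ℝ≥0∞) := by
    have h1 : Measurable fun z : (EuclideanSpace ℝ (Fin n) × ℝ) × EuclideanSpace ℝ (Fin n) =>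
        (t₀ - z.1.2, z.1.1 - z.2) := by fun_prop
    exact (ENNReal.measurable_ofReal.comp (hK.comp h1)).mul (by fun_prop)
  have hinner : Measurable (Function.uncurry fun (x : EuclideanSpace ℝ (Fin n)) (s : ℝ) =>
      ∫⁻ y : EuclideanSpace ℝ (Fin n),
        ENNReal.ofReal (fracHeatKernel n α (t₀ - s) (x - y)) * (F (s, y) : ℝ≥0∞)) :=
    Measurable.lintegral_prod_right' hjoint
  refine le_trans ?_ (setLIntegral_mul_le_mixedNorm n hq hF (m := fun s => min (volume B)⁻¹
      (ENNReal.ofReal (A * s ^ (-((n : ℝ) / (2 * α))))) ^ (1 / p)) (by fun_prop) t₀)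
  have hkey : volume B * 1 ≤ volume B * ∫⁻ s in Ioo 0 t₀, min (volume B)⁻¹
      (ENNReal.ofReal (A * (t₀ - s) ^ (-((n : ℝ) / (2 * α))))) ^ (1 / p) *
        (∫⁻ y : EuclideanSpace ℝ (Fin n), (F (s, y) : ℝ≥0∞) ^ p) ^ (1 / p) := by
    calc volume B * 1 = ∫⁻ x in B, 1 := by simp
      _ ≤ ∫⁻ x in B, fracPotential n α F (t₀, x) := setLIntegral_mono' hBm hSF
      _ = ∫⁻ s in Ioo 0 t₀, ∫⁻ x in B, ∫⁻ y : EuclideanSpace ℝ (Fin n),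
          ENNReal.ofReal (fracHeatKernel n α (t₀ - s) (x - y)) * (F (s, y) : ℝ≥0∞) := by
          unfold fracPotential
          exact lintegral_lintegral_swap (μ := volume.restrict B)
            (ν := volume.restrict (Ioo 0 t₀)) hinner.aemeasurable
      _ ≤ ∫⁻ s in Ioo 0 t₀, volume B * (min (volume B)⁻¹
          (ENNReal.ofReal (A * (t₀ - s) ^ (-((n : ℝ) / (2 * α))))) ^ (1 / p) *
            (∫⁻ y : EuclideanSpace ℝ (Fin n), (F (s, y) : ℝ≥0∞) ^ p) ^ (1 / p)) := by
          refine setLIntegral_mono' measurableSet_Ioo fun s hs => ?_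
          have hs' : 0 < t₀ - s := sub_pos.2 hs.2
          exact setLIntegral_convolution_le
            (k := fun x => ENNReal.ofReal (fracHeatKernel n α (t₀ - s) x))
            (measurable_fracHeatKernel_right n α _).ennreal_ofReal (by fun_prop)
            (lintegral_fracHeatKernel_le_one n hα₀ hα₁ hs')
            (fun x => ENNReal.ofReal_le_ofReal (hA _ hs' x)) hB0 hB hp
      _ = _ := lintegral_const_mul' _ _ hB
  exact (ENNReal.mul_le_mul_iff_right hB0 hB).1 hkey

theorem exists_le_parabolicCap (n : ℕ) {α p q q' : ℝ} (hα₀ : 0 < α)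
    (hα₁ : α < 1) (hp : 1 ≤ p) (hq : q.HolderConjugate q') :
    ∃ M : ℝ, 0 < M ∧ ∀ t₀ : ℝ, 0 < t₀ → ∀ (x₀ : EuclideanSpace ℝ (Fin n)) (r : ℝ), 0 < r →
      ∀ I : ℝ, 0 < I →
        ∫⁻ s in Ioo 0 t₀, ENNReal.ofReal (max s (r ^ (2 * α)) ^ (-((n : ℝ) / (2 * α) / p * q'))) ≤
          ENNReal.ofReal I →
        ENNReal.ofReal ((M * I) ^ (-(min p q / q'))) ≤
          parabolicCap n α p q (parabolicBall n α r t₀ x₀) := by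
  obtain ⟨A, hA0, hA⟩ := exists_fracHeatKernel_le n hα₀
  have hp0 : 0 < p := by linarith
  have hq0 : 0 < q := hq.pos
  have hq'0 : 0 < q' := hq.symm.pos
  have hpq : 0 < min p q := lt_min hp0 hq0
  set v : ℝ := (volume (Metric.closedBall (0 : EuclideanSpace ℝ (Fin n)) (1 / 2))).toReal with hv
  have hvfin : volume (Metric.closedBall (0 : EuclideanSpace ℝ (Fin n)) (1 / 2)) ≠ ∞ :=
    measure_closedBall_lt_top.ne
  have hvpos : 0 < v := ENNReal.toReal_pos
    (Metric.measure_closedBall_pos _ _ (by norm_num)).ne' hvfin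
  -- One constant for both regimes: the inverse volume of B governs s ≤ r^{2α}, the kernel bound
  -- governs s ≥ r^{2α}.
  set Λ : ℝ := max v⁻¹ A with hΛ
  have hΛpos : 0 < Λ := lt_max_of_lt_right hA0
  refine ⟨Λ ^ (1 / p * q'), by positivity, fun t₀ ht₀ x₀ r hr I hI hint => ?_⟩
  -- Half the radius makes the slice {t₀} × B compact inside the open ball, hence admissible in the
  -- supremum for every open G containing the ball.
  set B := Metric.closedBall x₀ (r * (1 / 2)) with hBdef
  have hBvol : volume B = ENNReal.ofReal (r ^ n * v) := by
    have := Measure.addHaar_closedBall_mul (volume : Measure (EuclideanSpace ℝ (Fin n))) x₀ hr.le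
      (s := 1 / 2) (by norm_num)
    rw [finrank_euclideanSpace_fin] at this
    rw [hBdef, this, ENNReal.ofReal_mul (by positivity), hv, ENNReal.ofReal_toReal hvfin]
  have hB0 : volume B ≠ 0 := by
    rw [hBvol]; exact (ENNReal.ofReal_pos.2 (by positivity)).ne'
  have hBfin : volume B ≠ ∞ := by rw [hBvol]; exact ENNReal.ofReal_ne_top
  have hbound : ∀ s ∈ Ioo 0 t₀, (min (volume B)⁻¹
      (ENNReal.ofReal (A * s ^ (-((n : ℝ) / (2 * α))))) ^ (1 / p)) ^ q' ≤
      ENNReal.ofReal (Λ ^ (1 / p * q')) *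
        ENNReal.ofReal (max s (r ^ (2 * α)) ^ (-((n : ℝ) / (2 * α) / p * q'))) := by
    intro s hs
    have hs0 : 0 < s := hs.1
    have hmaxpos : 0 < max s (r ^ (2 * α)) := lt_max_of_lt_left hs0
    have h1 : min (volume B)⁻¹ (ENNReal.ofReal (A * s ^ (-((n : ℝ) / (2 * α))))) ≤
        ENNReal.ofReal (Λ * max s (r ^ (2 * α)) ^ (-((n : ℝ) / (2 * α)))) := by
      rcases le_total s (r ^ (2 * α)) with h | h
      · refine min_le_of_left_le ?_
        rw [max_eq_right h, hBvol, ← ENNReal.ofReal_inv_of_pos (by positivity)]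
        refine ENNReal.ofReal_le_ofReal ?_
        rw [← Real.rpow_mul hr.le, mul_inv, mul_comm]
        have : 2 * α * -((n : ℝ) / (2 * α)) = -(n : ℝ) := by field_simp
        rw [this, Real.rpow_neg hr.le, Real.rpow_natCast]
        gcongr
        exact le_max_left _ _
      · refine min_le_of_right_le ?_
        rw [max_eq_left h]
        gcongr
        exact le_max_right _ _
    calc _ ≤ (ENNReal.ofReal (Λ * max s (r ^ (2 * α)) ^ (-((n : ℝ) / (2 * α)))) ^ (1 / p)) ^ q' := by
          gcongr
      _ = _ := by
          rw [← ENNReal.rpow_mul, ENNReal.ofReal_rpow_of_nonneg (by positivity) (by positivity),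
            Real.mul_rpow (by positivity) (by positivity), ← Real.rpow_mul hmaxpos.le,
            ENNReal.ofReal_mul (by positivity)]
          congr 3
          ring
  have hJ : ∫⁻ s in Ioo 0 t₀, (min (volume B)⁻¹
      (ENNReal.ofReal (A * s ^ (-((n : ℝ) / (2 * α))))) ^ (1 / p)) ^ q' ≤
      ENNReal.ofReal (Λ ^ (1 / p * q') * I) := by
    refine (setLIntegral_mono' measurableSet_Ioo hbound).trans ?_
    rw [lintegral_const_mul _ (by fun_prop), ENNReal.ofReal_mul (by positivity)]
    gcongr
  set X : ℝ≥0∞ := ENNReal.ofReal (Λ ^ (1 / p * q') * I) with hX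
  have hMI : 0 < Λ ^ (1 / p * q') * I := by positivity
  have hsub : ({t₀} : Set ℝ) ×ˢ B ⊆ parabolicBall n α r t₀ x₀ := by
    rintro ⟨t, x⟩ ⟨ht, hx⟩
    rw [mem_singleton_iff] at ht
    simp only at ht hx
    subst ht
    refine ⟨ht₀, ?_, ?_⟩
    · simp only [sub_self, abs_zero]
      positivity
    · rw [hBdef, Metric.mem_closedBall, dist_eq_norm] at hx
      simp only
      linarith
  have hcap : ENNReal.ofReal ((Λ ^ (1 / p * q') * I) ^ (-(min p q / q'))) ≤
      capCompact n α p q ({t₀} ×ˢ B) := by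
    unfold capCompact
    refine le_iInf fun F => le_iInf fun hF => le_iInf fun hSF => ?_
    have h1 := one_le_mul_mixedNorm_of_one_le_fracPotential n hα₀ hα₁ hp hq hA hF hB0 hBfin
      Metric.isClosed_closedBall.measurableSet (t₀ := t₀) (fun x hx => hSF _ ⟨rfl, hx⟩)
    have h2 : 1 ≤ mixedNorm n p q F * X ^ (1 / q') := by
      rw [mul_comm]
      refine h1.trans ?_
      gcongr
    have h3 := ENNReal.div_le_of_le_mul h2
    rw [one_div, ← ENNReal.rpow_neg] at h3
    have h4 := ENNReal.rpow_le_rpow h3 hpq.le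
    rw [← ENNReal.rpow_mul, hX, ENNReal.ofReal_rpow_of_pos hMI] at h4
    have h5 : -(1 / q') * min p q = -(min p q / q') := by ring
    rwa [h5] at h4
  refine hcap.trans ?_
  unfold parabolicCap
  refine le_iInf fun G => le_iInf fun _ => le_iInf fun hEG => le_iInf fun _ => ?_
  unfold capOpen
  exact le_iSup_of_le _ (le_iSup_of_le (isCompact_singleton.prod (isCompact_closedBall _ _))
    (le_iSup_of_le (hsub.trans hEG) le_rfl))

/-! ### Time integrals: the power case and the logarithmic case -/

theorem setLIntegral_ofReal_inv_Ioo {a b : ℝ} (ha : 0 < a) (hab : a ≤ b) :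
    ∫⁻ s in Ioo a b, ENNReal.ofReal s⁻¹ = ENNReal.ofReal (Real.log (b / a)) := by
  have hint : IntegrableOn (fun s : ℝ => s⁻¹) (Ioc a b) := by
    rw [← intervalIntegrable_iff_integrableOn_Ioc_of_le hab]
    refine intervalIntegral.intervalIntegrable_inv (fun x hx => ?_) continuousOn_id
    rw [uIcc_of_le hab] at hx
    exact (ha.trans_le hx.1).ne'
  rw [setLIntegral_congr Ioo_ae_eq_Ioc, ← ofReal_integral_eq_lintegral_ofReal hint,
    ← intervalIntegral.integral_of_le hab, integral_inv_of_pos ha (ha.trans_le hab)]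
  filter_upwards [ae_restrict_mem measurableSet_Ioc] with s hs
  exact inv_nonneg.2 (ha.trans hs.1).le

theorem setLIntegral_max_rpow_neg_le {ρ : ℝ} (hρ : 0 < ρ) (t a : ℝ) :
    ∫⁻ s in Ioo 0 t, ENNReal.ofReal (max s ρ ^ (-a)) ≤
      ENNReal.ofReal (ρ ^ (1 - a)) + ∫⁻ s in Ioo ρ t, ENNReal.ofReal (s ^ (-a)) := by
  have hsub : Ioo 0 t ⊆ Ioc 0 ρ ∪ Ioo ρ t := fun s hs => by
    rcases le_or_gt s ρ with h | h
    · exact Or.inl ⟨hs.1, h⟩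
    · exact Or.inr ⟨h, hs.2⟩
  refine (lintegral_mono_set hsub).trans ((lintegral_union_le _ _ _).trans (add_le_add ?_ ?_))
  · calc ∫⁻ s in Ioc 0 ρ, ENNReal.ofReal (max s ρ ^ (-a))
        = ∫⁻ s in Ioc 0 ρ, ENNReal.ofReal (ρ ^ (-a)) :=
          setLIntegral_congr_fun measurableSet_Ioc fun s hs => by
            rw [max_eq_right hs.2]
      _ = ENNReal.ofReal (ρ ^ (1 - a)) := by
          rw [setLIntegral_const, Real.volume_Ioc, sub_zero, ← ENNReal.ofReal_mul (by positivity),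
            ← Real.rpow_add_one hρ.ne']
          congr 2
          ring
      _ ≤ ENNReal.ofReal (ρ ^ (1 - a)) := le_rfl
  · refine (setLIntegral_congr_fun measurableSet_Ioo fun s hs => ?_).le
    rw [max_eq_left hs.1.le]

theorem setLIntegral_max_rpow_neg_le_of_one_lt {ρ a : ℝ} (hρ : 0 < ρ) (ha : 1 < a) (t : ℝ) :
    ∫⁻ s in Ioo 0 t, ENNReal.ofReal (max s ρ ^ (-a)) ≤
      ENNReal.ofReal ((1 + 1 / (a - 1)) * ρ ^ (1 - a)) := by
  have ha' : 0 < a - 1 := by linarith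
  refine (setLIntegral_max_rpow_neg_le hρ t a).trans ?_
  rw [add_mul, one_mul, ENNReal.ofReal_add (by positivity) (by positivity)]
  gcongr
  refine (lintegral_mono_set Ioo_subset_Ioi_self).trans ?_
  rw [← ofReal_integral_eq_lintegral_ofReal (integrableOn_Ioi_rpow_of_lt (by linarith) hρ),
    integral_Ioi_rpow_of_lt (by linarith) hρ]
  · refine ENNReal.ofReal_le_ofReal (le_of_eq ?_)
    have h1 : -a + 1 = -(a - 1) := by ring
    have h2 : 1 - a = -(a - 1) := by ring
    rw [h1, h2]
    field_simp
  · filter_upwards [ae_restrict_mem measurableSet_Ioi] with s hs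
    exact Real.rpow_nonneg (hρ.trans hs).le _

theorem setLIntegral_max_rpow_neg_one_le {ρ t : ℝ} (hρ : 0 < ρ) (ht : ρ ≤ t) :
    ∫⁻ s in Ioo 0 t, ENNReal.ofReal (max s ρ ^ (-1 : ℝ)) ≤
      ENNReal.ofReal (1 + Real.log (t / ρ)) := by
  refine (setLIntegral_max_rpow_neg_le hρ t 1).trans ?_
  rw [ENNReal.ofReal_add zero_le_one (Real.log_nonneg ((one_le_div hρ).2 ht)),
    ← setLIntegral_ofReal_inv_Ioo hρ ht]
  simp [Real.rpow_neg_one]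

/-! ### Upper bound for the capacity -/

theorem lintegral_indicator_Ioo_inv_comp_sub_left {a b c : ℝ} (ha : 0 < a) (hab : a ≤ b)
    (hc : 0 ≤ c) (t : ℝ) :
    ∫⁻ s, (Ioo a b).indicator (fun τ => ENNReal.ofReal (c * τ⁻¹)) (t - s) =
      ENNReal.ofReal (c * Real.log (b / a)) := by
  rw [lintegral_sub_left_eq_self ((Ioo a b).indicator fun τ => ENNReal.ofReal (c * τ⁻¹)) t,
    lintegral_indicator measurableSet_Ioo]
  simp_rw [ENNReal.ofReal_mul hc]
  rw [lintegral_const_mul _ (by fun_prop), setLIntegral_ofReal_inv_Ioo ha hab]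

theorem isOpen_parabolicBall (n : ℕ) (α r t₀ : ℝ) (x₀ : EuclideanSpace ℝ (Fin n)) :
    IsOpen (parabolicBall n α r t₀ x₀) := by
  have h1 : IsOpen {z : ℝ × EuclideanSpace ℝ (Fin n) | 0 < z.1} :=
    isOpen_lt continuous_const continuous_fst
  have h2 : IsOpen {z : ℝ × EuclideanSpace ℝ (Fin n) | |z.1 - t₀| < r ^ (2 * α)} :=
    isOpen_lt (by fun_prop) continuous_const
  have h3 : IsOpen {z : ℝ × EuclideanSpace ℝ (Fin n) | ‖z.2 - x₀‖ < r} :=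
    isOpen_lt (by fun_prop) continuous_const
  exact h1.inter (h2.inter h3)

/-- The ball is open, so it competes in its own outer infimum, and one F serves all its compact
subsets. -/
theorem parabolicCap_le_of_one_le_fracPotential (n : ℕ) {α p q : ℝ} {r t₀ : ℝ}
    {x₀ : EuclideanSpace ℝ (Fin n)} {F : ℝ × EuclideanSpace ℝ (Fin n) → ℝ≥0}
    (hF : Measurable F) (hSF : ∀ z ∈ parabolicBall n α r t₀ x₀, 1 ≤ fracPotential n α F z) :
    parabolicCap n α p q (parabolicBall n α r t₀ x₀) ≤ mixedNorm n p q F ^ min p q := by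
  unfold parabolicCap
  refine iInf_le_of_le (parabolicBall n α r t₀ x₀) (iInf_le_of_le
    (isOpen_parabolicBall n α r t₀ x₀) (iInf_le_of_le subset_rfl
      (iInf_le_of_le (fun z hz => hz.1) ?_)))
  refine iSup_le fun K => iSup_le fun _ => iSup_le fun hKG => ?_
  exact iInf_le_of_le F (iInf_le_of_le hF (iInf_le_of_le (fun z hz => hSF z (hKG hz)) le_rfl))

theorem volume_closedBall_mul_rpow (n : ℕ) {α τ : ℝ} (hτ : 0 < τ) (ε : ℝ) (hε : 0 < ε)
    (x₀ : EuclideanSpace ℝ (Fin n)) :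
    volume (Metric.closedBall x₀ (ε * τ ^ (1 / (2 * α)))) =
      ENNReal.ofReal (τ ^ ((n : ℝ) / (2 * α)) *
        (volume (Metric.closedBall (0 : EuclideanSpace ℝ (Fin n)) ε)).toReal) := by
  have h := Measure.addHaar_closedBall_mul (volume : Measure (EuclideanSpace ℝ (Fin n))) x₀
    (Real.rpow_pos_of_pos hτ (1 / (2 * α))).le (s := ε) hε.le
  rw [mul_comm, h, finrank_euclideanSpace_fin, ENNReal.ofReal_mul (by positivity),
    ENNReal.ofReal_toReal measure_closedBall_lt_top.ne, ← Real.rpow_natCast, ← Real.rpow_mul hτ.le]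
  congr 3
  ring

/-- The function `(s, y) ↦ c / (t₀ - s)` cut off to the part `a < t₀ - s < b` of the
backward paraboloid `‖y - x₀‖ ≤ ε (t₀ - s) ^ (1 / 2α)`. -/
noncomputable def paraboloidFun (n : ℕ) (α ε a b c t₀ : ℝ) (x₀ : EuclideanSpace ℝ (Fin n)) :
    ℝ × EuclideanSpace ℝ (Fin n) → ℝ≥0 :=
  {z | t₀ - z.1 ∈ Ioo a b ∧ ‖z.2 - x₀‖ ≤ ε * (t₀ - z.1) ^ (1 / (2 * α))}.indicator
    fun z => (c * (t₀ - z.1)⁻¹).toNNReal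

theorem measurable_paraboloidFun (n : ℕ) (α ε a b c t₀ : ℝ) (x₀ : EuclideanSpace ℝ (Fin n)) :
    Measurable (paraboloidFun n α ε a b c t₀ x₀) := by
  refine Measurable.indicator (by fun_prop) ?_
  have h1 : MeasurableSet {z : ℝ × EuclideanSpace ℝ (Fin n) | t₀ - z.1 ∈ Ioo a b} :=
    measurableSet_Ioo.preimage (f := fun z : ℝ × EuclideanSpace ℝ (Fin n) => t₀ - z.1)
      (by fun_prop)
  have h2 : MeasurableSet {z : ℝ × EuclideanSpace ℝ (Fin n) |
      ‖z.2 - x₀‖ ≤ ε * (t₀ - z.1) ^ (1 / (2 * α))} :=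
    measurableSet_le (by fun_prop) (by fun_prop)
  exact h1.inter h2

theorem paraboloidFun_apply_of_mem (n : ℕ) {α ε a b c t₀ s : ℝ} (x₀ y : EuclideanSpace ℝ (Fin n))
    (hs : t₀ - s ∈ Ioo a b) :
    (paraboloidFun n α ε a b c t₀ x₀ (s, y) : ℝ≥0∞) =
      (Metric.closedBall x₀ (ε * (t₀ - s) ^ (1 / (2 * α)))).indicator
        (fun _ => ENNReal.ofReal (c * (t₀ - s)⁻¹)) y := by
  unfold paraboloidFun
  by_cases hy : ‖y - x₀‖ ≤ ε * (t₀ - s) ^ (1 / (2 * α))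
  · have hmem : (s, y) ∈ {z : ℝ × EuclideanSpace ℝ (Fin n) |
        t₀ - z.1 ∈ Ioo a b ∧ ‖z.2 - x₀‖ ≤ ε * (t₀ - z.1) ^ (1 / (2 * α))} := ⟨hs, hy⟩
    rw [indicator_of_mem hmem,
      indicator_of_mem (by rwa [Metric.mem_closedBall, dist_eq_norm])]
    rfl
  · rw [indicator_of_notMem (fun h => hy h.2),
      indicator_of_notMem (by rwa [Metric.mem_closedBall, dist_eq_norm])]
    rfl

theorem paraboloidFun_apply_of_notMem (n : ℕ) {α ε a b c t₀ s : ℝ}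
    (x₀ y : EuclideanSpace ℝ (Fin n)) (hs : t₀ - s ∉ Ioo a b) :
    paraboloidFun n α ε a b c t₀ x₀ (s, y) = 0 :=
  indicator_of_notMem (fun h => hs h.1) _

/-- The section at elapsed time τ has volume proportional to τ^(n/2α), so the q-th power of its L^p
norm is a constant times τ^(qd/2α) τ⁻¹. As d ≥ 0, the first factor is at most its value at b, and
the rest integrates to a logarithm. -/
theorem mixedNorm_paraboloidFun_le (n : ℕ) {α p q ε a b c : ℝ} (hp : 0 < p)
    (hq : 0 < q) (hd : 0 ≤ (n : ℝ) / p + 2 * α / q - 2 * α) (hα : 0 < α) (hε : 0 < ε) (ha : 0 < a)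
    (hab : a ≤ b) (hc : 0 < c) (t₀ : ℝ) (x₀ : EuclideanSpace ℝ (Fin n)) :
    mixedNorm n p q (paraboloidFun n α ε a b c t₀ x₀) ≤
      ENNReal.ofReal (c *
        (volume (Metric.closedBall (0 : EuclideanSpace ℝ (Fin n)) ε)).toReal ^ (1 / p) *
        b ^ (((n : ℝ) / p + 2 * α / q - 2 * α) / (2 * α)) * Real.log (b / a) ^ (1 / q)) := by
  set w := (volume (Metric.closedBall (0 : EuclideanSpace ℝ (Fin n)) ε)).toReal with hw
  set d := (n : ℝ) / p + 2 * α / q - 2 * α with hd'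
  have hw0 : 0 ≤ w := ENNReal.toReal_nonneg
  have hb : 0 < b := ha.trans_le hab
  have hlog : 0 ≤ Real.log (b / a) := Real.log_nonneg ((one_le_div ha).2 hab)
  have hpt : ∀ s : ℝ, (∫⁻ y : EuclideanSpace ℝ (Fin n),
        (paraboloidFun n α ε a b c t₀ x₀ (s, y) : ℝ≥0∞) ^ p) ^ (q / p) ≤
      (Ioo a b).indicator (fun τ => ENNReal.ofReal
        (c ^ q * w ^ (q / p) * b ^ (q * d / (2 * α)) * τ⁻¹)) (t₀ - s) := by
    intro s
    by_cases hs : t₀ - s ∈ Ioo a b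
    · rw [indicator_of_mem hs]
      set τ := t₀ - s with hτ
      have hτ0 : 0 < τ := ha.trans hs.1
      have h1 : ∫⁻ y : EuclideanSpace ℝ (Fin n),
          (paraboloidFun n α ε a b c t₀ x₀ (s, y) : ℝ≥0∞) ^ p =
          ENNReal.ofReal ((c * τ⁻¹) ^ p * (τ ^ ((n : ℝ) / (2 * α)) * w)) := by
        have h2 : ∀ y : EuclideanSpace ℝ (Fin n),
            (paraboloidFun n α ε a b c t₀ x₀ (s, y) : ℝ≥0∞) ^ p =
            (Metric.closedBall x₀ (ε * τ ^ (1 / (2 * α)))).indicator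
              (fun _ => ENNReal.ofReal ((c * τ⁻¹) ^ p)) y := fun y => by
          rw [paraboloidFun_apply_of_mem n x₀ y hs]
          by_cases hy : y ∈ Metric.closedBall x₀ (ε * τ ^ (1 / (2 * α)))
          · rw [indicator_of_mem hy, indicator_of_mem hy,
              ENNReal.ofReal_rpow_of_nonneg (by positivity) hp.le]
          · rw [indicator_of_notMem hy, indicator_of_notMem hy, ENNReal.zero_rpow_of_pos hp]
        simp_rw [h2]
        rw [lintegral_indicator Metric.isClosed_closedBall.measurableSet, setLIntegral_const,
          volume_closedBall_mul_rpow n hτ0 ε hε, ← hw,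
          ← ENNReal.ofReal_mul (by positivity)]
      rw [h1, ENNReal.ofReal_rpow_of_nonneg (by positivity) (by positivity)]
      refine ENNReal.ofReal_le_ofReal ?_
      have h3 : ((c * τ⁻¹) ^ p * (τ ^ ((n : ℝ) / (2 * α)) * w)) ^ (q / p) =
          c ^ q * w ^ (q / p) * τ ^ (q * d / (2 * α)) * τ⁻¹ := by
        rw [Real.mul_rpow (by positivity) (by positivity), Real.mul_rpow (by positivity) hw0,
          ← Real.rpow_mul (by positivity), ← Real.rpow_mul (by positivity),
          mul_div_cancel₀ _ hp.ne', Real.mul_rpow hc.le (by positivity), Real.inv_rpow hτ0.le,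
          ← Real.rpow_neg hτ0.le, ← Real.rpow_neg_one τ]
        have h4 : τ ^ (-q) * τ ^ ((n : ℝ) / (2 * α) * (q / p)) =
            τ ^ (q * d / (2 * α)) * τ ^ (-1 : ℝ) := by
          rw [← Real.rpow_add hτ0, ← Real.rpow_add hτ0]
          congr 1
          rw [hd']
          field_simp
          ring
        linear_combination c ^ q * w ^ (q / p) * h4
      rw [h3]
      have : 0 ≤ q * d / (2 * α) := by positivity
      gcongr
      exact hs.2.le
    · rw [indicator_of_notMem hs]
      simp_rw [paraboloidFun_apply_of_notMem n x₀ _ hs]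
      simp [hp, hq]
  have e1 : q / p * (1 / q) = 1 / p := by field_simp
  have e2 : q * d / (2 * α) * (1 / q) = d / (2 * α) := by field_simp
  unfold mixedNorm
  calc _ ≤ (ENNReal.ofReal (c ^ q * w ^ (q / p) * b ^ (q * d / (2 * α)) * Real.log (b / a))) ^
        (1 / q) := by
        refine ENNReal.rpow_le_rpow ?_ (by positivity)
        rw [← lintegral_indicator_Ioo_inv_comp_sub_left ha hab (by positivity) t₀]
        exact (setLIntegral_le_lintegral _ _).trans (lintegral_mono hpt)
    _ = _ := by
        rw [ENNReal.ofReal_rpow_of_nonneg (by positivity) (by positivity),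
          Real.mul_rpow (by positivity) hlog, Real.mul_rpow (by positivity) (by positivity),
          Real.mul_rpow (by positivity) (by positivity), ← Real.rpow_mul hc.le,
          ← Real.rpow_mul hw0, ← Real.rpow_mul hb.le,
          mul_one_div_cancel hq.ne', Real.rpow_one, e1, e2]

/-- The lower limit a keeps the support far from the ball on the parabolic scale: for (t, x) in the
ball, t - s lies between τ/2 and 2τ and ‖x - y‖ ≤ 2δ τ^(1/2α) = ε (τ/2)^(1/2α). The near-diagonal
kernel bound thus applies, and the section volume cancels τ^(-n/2α). -/
theorem le_fracPotential_paraboloidFun (n : ℕ) {α κ ε δ a b c t₀ r : ℝ}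
    (hα : 0 < α) (hκ : 0 < κ)
    (hker : ∀ t : ℝ, 0 < t → ∀ x : EuclideanSpace ℝ (Fin n),
      ‖x‖ ≤ ε * t ^ (1 / (2 * α)) → κ * t ^ (-((n : ℝ) / (2 * α))) ≤ fracHeatKernel n α t x)
    (hε : 0 < ε) (hδ : 0 < δ) (hδε : δ = ε * (1 / 2) ^ (1 / (2 * α)) / 2) (ha : 0 < a)
    (hab : a ≤ b) (hb : b ≤ t₀) (hc : 0 < c) (har : 2 * r ^ (2 * α) ≤ a)
    (har' : r ≤ δ * a ^ (1 / (2 * α))) {x₀ : EuclideanSpace ℝ (Fin n)}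
    {z : ℝ × EuclideanSpace ℝ (Fin n)} (hz : z ∈ parabolicBall n α r t₀ x₀) :
    ENNReal.ofReal (c * (κ * 2 ^ (-((n : ℝ) / (2 * α))) *
      (volume (Metric.closedBall (0 : EuclideanSpace ℝ (Fin n)) δ)).toReal) *
        Real.log (b / a)) ≤ fracPotential n α (paraboloidFun n α δ a b c t₀ x₀) z := by
  obtain ⟨t, x⟩ := z
  obtain ⟨ht, htt, hxx⟩ := hz
  simp only at ht htt hxx
  set w := (volume (Metric.closedBall (0 : EuclideanSpace ℝ (Fin n)) δ)).toReal with hw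
  have hw0 : 0 ≤ w := ENNReal.toReal_nonneg
  rw [← lintegral_indicator_Ioo_inv_comp_sub_left ha hab (by positivity) t₀]
  unfold fracPotential
  rw [← lintegral_indicator measurableSet_Ioo]
  refine lintegral_mono fun s => ?_
  by_cases hs : t₀ - s ∈ Ioo a b
  swap
  · rw [indicator_of_notMem hs]
    exact zero_le
  obtain ⟨ht1, ht2⟩ := abs_lt.1 htt
  -- Positivity of s comes from τ < b ≤ t₀; s < t comes from |t - t₀| < r^{2α} ≤ a/2 < τ.
  have hsm : s ∈ Ioo 0 t := ⟨by linarith [hs.2], by linarith [hs.1]⟩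
  rw [indicator_of_mem hs, indicator_of_mem hsm]
  set τ := t₀ - s with hτ
  have hτ0 : 0 < τ := ha.trans hs.1
  have hts1 : 1 / 2 * τ ≤ t - s := by linarith [hs.1]
  have hts2 : t - s ≤ 2 * τ := by linarith [hs.1]
  have hts0 : 0 < t - s := by linarith
  have hlow : ∀ y : EuclideanSpace ℝ (Fin n),
      (Metric.closedBall x₀ (δ * τ ^ (1 / (2 * α)))).indicator (fun _ =>
        ENNReal.ofReal (κ * 2 ^ (-((n : ℝ) / (2 * α))) * τ ^ (-((n : ℝ) / (2 * α))) *
          (c * τ⁻¹))) y ≤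
      ENNReal.ofReal (fracHeatKernel n α (t - s) (x - y)) *
        (paraboloidFun n α δ a b c t₀ x₀ (s, y) : ℝ≥0∞) := fun y => by
    rw [paraboloidFun_apply_of_mem n x₀ y hs]
    by_cases hy : y ∈ Metric.closedBall x₀ (δ * τ ^ (1 / (2 * α)))
    swap
    · rw [indicator_of_notMem hy]
      exact zero_le
    rw [indicator_of_mem hy, indicator_of_mem hy, ENNReal.ofReal_mul (by positivity)]
    refine mul_le_mul_left (ENNReal.ofReal_le_ofReal ?_) _
    have hdist : ‖x - y‖ ≤ ε * (t - s) ^ (1 / (2 * α)) := by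
      rw [Metric.mem_closedBall, dist_eq_norm, norm_sub_rev] at hy
      have h1 : ‖x - y‖ ≤ ‖x - x₀‖ + ‖x₀ - y‖ := norm_sub_le_norm_sub_add_norm_sub _ _ _
      have h2 : δ * a ^ (1 / (2 * α)) ≤ δ * τ ^ (1 / (2 * α)) := by
        have := hs.1.le
        gcongr
      calc ‖x - y‖ ≤ 2 * (δ * τ ^ (1 / (2 * α))) := by linarith
        _ = ε * (1 / 2 * τ) ^ (1 / (2 * α)) := by
            rw [Real.mul_rpow (by norm_num) hτ0.le, hδε]; ring
        _ ≤ ε * (t - s) ^ (1 / (2 * α)) := by gcongr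
    refine le_trans ?_ (hker (t - s) hts0 _ hdist)
    rw [mul_assoc, ← Real.mul_rpow (by norm_num) hτ0.le]
    gcongr ?_ * ?_
    exact Real.rpow_le_rpow_of_nonpos hts0 hts2 (by rw [neg_nonpos]; positivity)
  refine le_trans (le_of_eq ?_) (lintegral_mono hlow)
  rw [lintegral_indicator Metric.isClosed_closedBall.measurableSet, setLIntegral_const,
    volume_closedBall_mul_rpow n hτ0 δ hδ, ← hw, ← ENNReal.ofReal_mul (by positivity)]
  congr 1
  have h1 : τ ^ (-((n : ℝ) / (2 * α))) * τ ^ ((n : ℝ) / (2 * α)) = 1 := by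
    rw [← Real.rpow_add hτ0, neg_add_cancel, Real.rpow_zero]
  linear_combination (-(c * κ * 2 ^ (-((n : ℝ) / (2 * α))) * w * τ⁻¹)) * h1

theorem exists_parabolicCap_le (n : ℕ) {α p q : ℝ} (hα : 0 < α) (hp : 0 < p) (hq : 0 < q)
    (hd : 0 ≤ (n : ℝ) / p + 2 * α / q - 2 * α) :
    ∃ A C : ℝ, 0 < A ∧ 0 < C ∧ ∀ (t₀ : ℝ) (x₀ : EuclideanSpace ℝ (Fin n)) (r a b : ℝ), 0 < r →
      A * r ^ (2 * α) ≤ a → a < b → b ≤ t₀ →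
        parabolicCap n α p q (parabolicBall n α r t₀ x₀) ≤
          ENNReal.ofReal ((C * (b ^ (((n : ℝ) / p + 2 * α / q - 2 * α) / (2 * α)) *
            Real.log (b / a) ^ (1 / q - 1))) ^ min p q) := by
  obtain ⟨κ, ε, hκ, hε, hker⟩ := exists_le_fracHeatKernel n hα
  set d := (n : ℝ) / p + 2 * α / q - 2 * α with hd'
  set δ : ℝ := ε * (1 / 2) ^ (1 / (2 * α)) / 2 with hδ'
  have hδ : 0 < δ := by positivity
  set w := (volume (Metric.closedBall (0 : EuclideanSpace ℝ (Fin n)) δ)).toReal with hw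
  have hw0 : 0 < w := ENNReal.toReal_pos (Metric.measure_closedBall_pos _ _ hδ).ne'
    measure_closedBall_lt_top.ne
  set K := κ * 2 ^ (-((n : ℝ) / (2 * α))) * w with hK
  have hK0 : 0 < K := by positivity
  -- The two entries of the maximum give 2 r^{2α} ≤ a (comparable times) and r ≤ δ a^(1/2α)
  -- (comparable positions).
  refine ⟨max 2 (δ⁻¹ ^ (2 * α)), K⁻¹ * w ^ (1 / p), by positivity, by positivity, ?_⟩
  intro t₀ x₀ r a b hr har hab hb
  have hr2 : 0 < r ^ (2 * α) := by positivity
  have ha2 : 2 * r ^ (2 * α) ≤ a := le_trans (by gcongr; exact le_max_left _ _) har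
  have ha0 : 0 < a := by linarith
  have ha3 : r ≤ δ * a ^ (1 / (2 * α)) := by
    have h1 : (δ⁻¹ * r) ^ (2 * α) ≤ a := by
      rw [Real.mul_rpow (by positivity) hr.le]
      exact le_trans (by gcongr; exact le_max_right _ _) har
    have h2 : ((δ⁻¹ * r) ^ (2 * α)) ^ (1 / (2 * α)) ≤ a ^ (1 / (2 * α)) := by gcongr
    rw [← Real.rpow_mul (by positivity), mul_one_div_cancel (by positivity), Real.rpow_one] at h2
    calc r = δ * (δ⁻¹ * r) := by field_simp
      _ ≤ _ := by gcongr
  have hlog : 0 < Real.log (b / a) := Real.log_pos ((one_lt_div ha0).2 hab)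
  -- Normalises the lower bound for the potential to exactly 1.
  set c : ℝ := (K * Real.log (b / a))⁻¹ with hc
  have hc0 : 0 < c := by positivity
  have hb0 : 0 < b := ha0.trans hab
  refine (parabolicCap_le_of_one_le_fracPotential n (measurable_paraboloidFun n α δ a b c t₀ x₀)
    fun z hz => ?_).trans ?_
  · refine le_trans (le_of_eq ?_) (le_fracPotential_paraboloidFun n hα hκ hker hε hδ hδ' ha0 hab.le
      hb hc0 ha2 ha3 hz)
    rw [← hw, ← hK, mul_assoc, hc, inv_mul_cancel₀ (by positivity), ENNReal.ofReal_one]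
  · have hpq : 0 < min p q := lt_min hp hq
    refine (ENNReal.rpow_le_rpow (mixedNorm_paraboloidFun_le n hp hq hd hα hδ ha0 hab.le hc0 t₀ x₀)
      hpq.le).trans (le_of_eq ?_)
    rw [ENNReal.ofReal_rpow_of_nonneg (by positivity) hpq.le, ← hd', ← hw]
    congr 2
    rw [Real.rpow_sub hlog, Real.rpow_one, hc, mul_inv]
    ring

/-! ### Assembly: choice of a, b and of the admissible radii -/

theorem theorem1p3 (n : ℕ) (hn : 1 ≤ n) (α p q : ℝ) (hα₀ : 0 < α) (hα₁ : α < 1)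
    (hp : 1 ≤ p) (hq : 1 < q) :
    (0 < (n : ℝ) / p + 2 * α / q - 2 * α →
      ∃ c C : ℝ, 0 < c ∧ 0 < C ∧ ∀ t₀ : ℝ, 0 < t₀ → ∃ δ : ℝ, 0 < δ ∧
        ∀ (x₀ : EuclideanSpace ℝ (Fin n)) (r : ℝ), 0 < r → r < δ →
          ENNReal.ofReal (c * r ^ (min p q * ((n : ℝ) / p + 2 * α / q - 2 * α))) ≤
              parabolicCap n α p q (parabolicBall n α r t₀ x₀) ∧
            parabolicCap n α p q (parabolicBall n α r t₀ x₀) ≤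
              ENNReal.ofReal (C * r ^ (min p q * ((n : ℝ) / p + 2 * α / q - 2 * α)))) ∧
    ((n : ℝ) / p + 2 * α / q - 2 * α = 0 →
      ∃ c C : ℝ, 0 < c ∧ 0 < C ∧ ∀ t₀ : ℝ, 0 < t₀ → ∃ δ : ℝ, 0 < δ ∧ δ < 1 ∧
        ∀ (x₀ : EuclideanSpace ℝ (Fin n)) (r : ℝ), 0 < r → r < δ →
          ENNReal.ofReal (c * Real.log (1 / r) ^ (min p q * (1 / q - 1))) ≤
              parabolicCap n α p q (parabolicBall n α r t₀ x₀) ∧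
            parabolicCap n α p q (parabolicBall n α r t₀ x₀) ≤
              ENNReal.ofReal (C * Real.log (1 / r) ^ (min p q * (1 / q - 1)))) := by
  have hp0 : 0 < p := by linarith
  have hq0 : 0 < q := by linarith
  have hqq := Real.HolderConjugate.conjExponent hq
  set q' := q.conjExponent with hq'
  have hq'0 : 0 < q' := hqq.symm.pos
  have hinv : 1 / q' = 1 - 1 / q := by
    have := hqq.inv_add_inv_eq_one
    rw [one_div, one_div]
    linarith
  have hpq : 0 < min p q := lt_min hp0 hq0
  set d := (n : ℝ) / p + 2 * α / q - 2 * α with hd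
  have hexp : (n : ℝ) / (2 * α) / p * q' = 1 + d * q' / (2 * α) := by
    have h1 : (n : ℝ) / p = d + 2 * α * (1 / q') := by rw [hinv, hd]; ring
    calc (n : ℝ) / (2 * α) / p * q' = (n : ℝ) / p * q' / (2 * α) := by ring
      _ = 1 + d * q' / (2 * α) := by rw [h1]; field_simp; ring
  obtain ⟨M, hM, hlower⟩ := exists_le_parabolicCap n hα₀ hα₁ hp hqq
  refine ⟨fun hdpos => ?_, fun hd0 => ?_⟩
  · obtain ⟨A, C, hA, hC, hupper⟩ := exists_parabolicCap_le n hα₀ hp0 hq0 hdpos.le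
    rw [← hd] at hupper
    set β := d * q' / (2 * α) with hβ
    have hβ0 : 0 < β := by positivity
    have hlog2 : 0 < Real.log 2 := Real.log_pos one_lt_two
    refine ⟨(M * (1 + 1 / β)) ^ (-(min p q / q')),
      (C * ((2 * A) ^ (d / (2 * α)) * Real.log 2 ^ (1 / q - 1))) ^ min p q,
      by positivity, by positivity, fun t₀ ht₀ =>
      -- This threshold ensures 2A r^{2α} ≤ t₀, so that b = 2a is admissible in the upper bound; the
      -- lower bound holds for every r > 0.
      ⟨(t₀ / (2 * A)) ^ (1 / (2 * α)), by positivity, fun x₀ r hr hrδ => ⟨?_, ?_⟩⟩⟩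
    · have hρ : 0 < r ^ (2 * α) := by positivity
      have hint := setLIntegral_max_rpow_neg_le_of_one_lt hρ
        (show 1 < 1 + β by linarith) t₀
      rw [add_sub_cancel_left, sub_add_cancel_left, ← hexp] at hint
      refine le_trans (le_of_eq ?_) (hlower t₀ ht₀ x₀ r hr
        ((1 + 1 / β) * (r ^ (2 * α)) ^ (-β)) (by positivity) hint)
      rw [← mul_assoc,
        Real.mul_rpow (x := M * (1 + 1 / β)) (by positivity) (by positivity),
        ← Real.rpow_mul hr.le, ← Real.rpow_mul hr.le]
      congr 3
      rw [hβ]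
      field_simp
    · have hrt : r ^ (2 * α) < t₀ / (2 * A) := by
        have h1 := Real.rpow_lt_rpow hr.le hrδ (show 0 < 2 * α by positivity)
        rwa [← Real.rpow_mul (by positivity), one_div_mul_cancel (by positivity),
          Real.rpow_one] at h1
      have hρ : 0 < r ^ (2 * α) := by positivity
      have hAρ : 0 < A * r ^ (2 * α) := by positivity
      rw [lt_div_iff₀ (by positivity)] at hrt
      refine (hupper t₀ x₀ r (A * r ^ (2 * α)) (2 * (A * r ^ (2 * α))) hr le_rfl (by linarith)
        (by linarith)).trans (le_of_eq ?_)
      congr 1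
      rw [mul_div_cancel_right₀ _ hAρ.ne', ← mul_assoc 2 A,
        Real.mul_rpow (x := 2 * A) (z := d / (2 * α)) (by positivity) (by positivity), ← Real.rpow_mul hr.le,
        mul_div_cancel₀ _ (by positivity : 2 * α ≠ 0)]
      have h2 : C * ((2 * A) ^ (d / (2 * α)) * r ^ d * Real.log 2 ^ (1 / q - 1)) =
          (C * ((2 * A) ^ (d / (2 * α)) * Real.log 2 ^ (1 / q - 1))) * r ^ d := by ring
      rw [h2, Real.mul_rpow (by positivity) (by positivity), ← Real.rpow_mul hr.le, mul_comm d]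
  · obtain ⟨A, C, hA, hC, hupper⟩ := exists_parabolicCap_le n hα₀ hp0 hq0 hd0.ge
    rw [← hd] at hupper
    have hq1' : 1 / q - 1 = -(1 / q') := by rw [hinv]; ring
    refine ⟨(M * (2 + 2 * α)) ^ (-(min p q / q')), (C * α ^ (1 / q - 1)) ^ min p q,
      by positivity, by positivity, fun t₀ ht₀ => ?_⟩
    have hlog_atTop : Filter.Tendsto (fun r : ℝ => Real.log (1 / r)) (nhdsWithin 0 (Ioi 0))
        Filter.atTop := by
      simp_rw [one_div]
      exact Real.tendsto_log_atTop.comp tendsto_inv_nhdsGT_zero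
    -- With L = ln(1/r), the thresholds 1 and ln t₀ give 1 + ln(t₀/r^{2α}) ≤ (2 + 2α)L, the third
    -- gives r^{2α} ≤ t₀, and the last gives ln(t₀/(A r^{2α})) ≥ αL. All dependence on t₀ is
    -- absorbed here, not in c and C.
    obtain ⟨δ, hδ, hsub⟩ := (mem_nhdsGT_iff_exists_Ioo_subset).1
      (hlog_atTop.eventually_ge_atTop (max 1 (max (Real.log t₀)
        (max (-Real.log t₀ / (2 * α)) (-Real.log (t₀ / A) / α)))))
    refine ⟨min δ (1 / 2), lt_min hδ (by norm_num), (min_le_right _ _).trans_lt (by norm_num),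
      fun x₀ r hr hrδ => ?_⟩
    have hL := hsub ⟨hr, hrδ.trans_le (min_le_left _ _)⟩
    simp only [mem_ofPred_eq, max_le_iff] at hL
    obtain ⟨hL1, hLt, hLt', hLA⟩ := hL
    rw [div_le_iff₀ (by positivity)] at hLt' hLA
    set L := Real.log (1 / r) with hLdef
    have hL0 : 0 < L := by linarith
    have hρ : 0 < r ^ (2 * α) := by positivity
    have hlogρ : Real.log (r ^ (2 * α)) = -(2 * α * L) := by
      rw [Real.log_rpow hr, hLdef, one_div, Real.log_inv]; ring
    refine ⟨?_, ?_⟩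
    · have hρt : r ^ (2 * α) ≤ t₀ := by
        rw [← Real.log_le_log_iff hρ ht₀, hlogρ]
        linarith
      have hI : ENNReal.ofReal (1 + Real.log (t₀ / r ^ (2 * α))) ≤
          ENNReal.ofReal ((2 + 2 * α) * L) := by
        refine ENNReal.ofReal_le_ofReal ?_
        rw [Real.log_div ht₀.ne' hρ.ne', hlogρ]
        linarith
      have hint := (setLIntegral_max_rpow_neg_one_le hρ hρt).trans hI
      have he : (-1 : ℝ) = -((n : ℝ) / (2 * α) / p * q') := by rw [hexp, hd0]; simp
      rw [he] at hint
      refine le_trans (le_of_eq ?_) (hlower t₀ ht₀ x₀ r hr _ (by positivity) hint)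
      rw [← mul_assoc, Real.mul_rpow (x := M * (2 + 2 * α)) (by positivity) hL0.le, hq1']
      congr 3
      ring
    · have hAρ : 0 < A * r ^ (2 * α) := by positivity
      have hloga : α * L ≤ Real.log (t₀ / (A * r ^ (2 * α))) := by
        rw [← div_div, Real.log_div (by positivity) hρ.ne', hlogρ]
        linarith
      have hαL : 0 < α * L := by positivity
      have hlt : A * r ^ (2 * α) < t₀ := by
        rw [← one_lt_div hAρ]
        by_contra! h
        have := Real.log_nonpos (by positivity) h
        linarith
      -- At d = 0 the power of b is trivial, so the largest b allowed, t₀, is best: since 1/q - 1 <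
      -- 0, a long logarithmic range lowers the bound.
      refine (hupper t₀ x₀ r _ t₀ hr le_rfl hlt le_rfl).trans (ENNReal.ofReal_le_ofReal ?_)
      rw [hd0, zero_div, Real.rpow_zero, one_mul]
      calc (C * Real.log (t₀ / (A * r ^ (2 * α))) ^ (1 / q - 1)) ^ min p q
          ≤ (C * (α * L) ^ (1 / q - 1)) ^ min p q := by
            have h1 : Real.log (t₀ / (A * r ^ (2 * α))) ^ (1 / q - 1) ≤
                (α * L) ^ (1 / q - 1) := by
              refine Real.rpow_le_rpow_of_nonpos hαL hloga ?_
              rw [hq1', neg_nonpos]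
              positivity
            have h2 : 0 ≤ Real.log (t₀ / (A * r ^ (2 * α))) := hαL.le.trans hloga
            gcongr
        _ = _ := by
            rw [Real.mul_rpow hα₀.le hL0.le, ← mul_assoc,
              Real.mul_rpow (by positivity) (by positivity), ← Real.rpow_mul hL0.le,
              mul_comm (min p q)]
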